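/- Let $G$ be a finite group (not necessarily abelian), let $g\ge 2$ and $n\ge 0$ be integers, and let $\mu=(r_1,\dots,r_n)$ be a tuple of positive integers, each dividing $\#G$. Put $k_i=\#G/r_i$ and $k=k_1+\dots+k_n$, assume that $n\cdot\#G-k$ is even, and put $g'=(g-1)\#G+1+(n\cdot\#G-k)/2$. Conventions. A graph $\Gamma$ is a finite set with an idempotent root map $r$, whose image is the set of vertices, and an involution fixing the vertices; the other elements are half-edges, and the orbits of half-edges of size $2$ and $1$ are the edges $E(\Gamma)$ and the legs $L(\Gamma)$. It is weighted if every vertex $v$ has a genus $g(v)\in\mathbb Z_{\ge 0}$; then $\chi(v)=2-2g(v)-\mathrm{val}(v)$, the graph is stable if $\chi(v)\le -1$ for all $v$, and a connected graph has genus $\#E-\#V+1+\sum_v g(v)$. A finite harmonic morphism $\varphi:\Gamma'\to\Gamma$ is a map commuting with root and involution maps, sending edges to edges and legs to legs, with degrees $d_\varphi(x')\in\mathbb Z_{>0}$ that agree on the two halves of an edge and satisfy $d_\varphi(v')=\sum_{h'\mapsto h,\ r(h')=v'}d_\varphi(h')$ for every vertex $v'$ and every half-edge $h$ rooted at $\varphi(v')$;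 it is unramified if $d_\varphi(v')\chi(\varphi(v'))=\chi(v')$ for all $v'$. An (unramified) $G$-cover is an (unramified) finite harmonic morphism of degree $\#G$ together with an action of $G$ on the weighted graph $\Gamma'$, not flipping edges, that leaves $\varphi$ and $d_\varphi$ invariant and is transitive on the fibers of $\varphi$. A stable tropical curve is given by its minimal model, a connected stable weighted graph with edge lengths $\ell(e)>0$; covers of tropical curves satisfy in addition $\ell(\varphi(e'))=d_\varphi(e')\ell'(e')$. Let $J_{g,G}(\mu)$ be the category whose objects are the triples $(\varphi:\Gamma'\to\Gamma,\,l,\,l')$, where $\varphi$ is an unramified $G$-cover of connected stable weighted graphs of genera $g'$ and $g$, and $l:\{1,\dots,n\}\simeq L(\Gamma)$ and $l':\{(i,j):1\le i\le n,\ 1\le j\le k_i\}\simeq L(\Gamma')$ are markings with $\varphi(l'_{ij})=l_i$. Its morphisms are generated by the $G$-equivariant isomorphisms preserving the markings and the weighted edge contractions $\varphi\to\varphi_S$ along sets $S\subset E(\Gamma)$: each connected component of the subgraph spanned by $S$ is contracted to a vertex having the genus of that component, $\Gamma'$ is contracted in the same way along $\varphi^{-1}(S)$, and $\varphi_S$ carries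 the induced action, markings and degrees. Let $\sigma_\varphi=\mathbb R_{\ge0}^{E(\Gamma)}$. An isomorphism permutes the coordinates, and a contraction along $S$ identifies $\sigma_{\varphi_S}$ with the face of $\sigma_\varphi$ on which the coordinates in $S$ vanish; this defines a functor from $J_{g,G}(\mu)^{\mathrm{op}}$ to the category of rational polyhedral cones with (not necessarily proper) face morphisms. Let $H^{trop}_{g,G}(\mu)$ be the set of isomorphism classes of marked unramified $G$-covers $[\varphi,l,l']$ of stable tropical curves, that is, of objects of $J_{g,G}(\mu)$ with edge lengths $\ell,\ell'$ as above. Then for every object $\varphi$ and every $a\in\sigma_\varphi$, contracting the edges $e$ with $a_e=0$ and taking the remaining $a_e$ as the edge lengths of the target gives a marked unramified $G$-cover of stable tropical curves, well defined up to isomorphism. The resulting maps $\pi_\varphi:\sigma_\varphi\to H^{trop}_{g,G}(\mu)$ commute with the face morphisms induced by $J_{g,G}(\mu)$ and induce a bijection $\varinjlim_{J_{g,G}(\mu)^{\mathrm{op}}}\sigma_\varphi\simeq H^{trop}_{g,G}(\mu)$. Moreover $J_{g,G}(\mu)$ has finitely many isomorphism classes of objects and finite sets of morphisms. Hence $H^{trop}_{g,G}(\mu)$,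 with the colimit topology, is a generalized cone complex, i.e. the topological colimit of a finite diagram of rational polyhedral cones with face morphisms. -/

import Mathlib

open CategoryTheory

universe u v w z

noncomputable section

namespace TropGCover

/-! ## Graphs with legs and weighted graphs -/

/-- A (finite) graph with legs: a finite set `X` of vertices and half-edges, an idempotent root map
`r` whose image is the set of vertices, and an involution `inv` that fixes the vertices. -/
structure LegGraph where
  X : Type
  [finite : Finite X]
  r : X → X
  inv : X → X
  r_r : ∀ x, r (r x) = r x
  inv_inv : ∀ x, inv (inv x) = x
  inv_r : ∀ x, inv (r x) = r x

attribute [instance] LegGraph.finite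

namespace LegGraph

variable (Γ : LegGraph)

/-- Being a vertex: as `r` is idempotent, its image is its set of fixed points. -/
def IsVertex (x : Γ.X) : Prop := Γ.r x = x

/-- The set `V(Γ)` of vertices. -/
abbrev Vertex : Type := {x : Γ.X // Γ.IsVertex x}

/-- The set `L(Γ)` of legs: the half-edges fixed by the involution. -/
abbrev Leg : Type := {x : Γ.X // ¬ Γ.IsVertex x ∧ Γ.inv x = x}

/-- The set `E(Γ)` of edges: the orbits of size two of the involution
(which consist of half-edges, since vertices are fixed). -/
abbrev Edge : Type := {e : Sym2 Γ.X // ∃ h, Γ.inv h ≠ h ∧ e = s(h, Γ.inv h)}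

/-- The valency of a vertex: the number of half-edges rooted at it. -/
def val (v : Γ.Vertex) : ℕ := Nat.card {h : Γ.X // ¬ Γ.IsVertex h ∧ Γ.r h = v.1}

/-- Connectedness. The empty graph is not connected. -/
def Connected : Prop :=
  Nonempty Γ.X ∧ ∀ x y, Relation.EqvGen (fun a b => b = Γ.r a ∨ b = Γ.inv a) x y

/-- `x` is a half-edge of an edge in `S` and `y` is its root or the other half of that edge. The
equivalence relation generated by this identifies the points that become equal in `Γ/S`. -/
def CollapseStep (S : Set Γ.Edge) (x y : Γ.X) : Prop :=
  (∃ e ∈ S, x ∈ e.1) ∧ (y = Γ.r x ∨ y = Γ.inv x)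

end LegGraph

/-- A weighted graph: a graph with a genus at each vertex. -/
structure WGraph extends LegGraph where
  w : toLegGraph.Vertex → ℕ

namespace WGraph

variable (Γ : WGraph)

/-- The Euler characteristic `2 - 2 g(v) - val(v)` of a vertex. -/
def chi (v : Γ.Vertex) : ℤ := 2 - 2 * (Γ.w v : ℤ) - (Γ.val v : ℤ)

/-- All vertices are stable. -/
def Stable : Prop := ∀ v, Γ.chi v ≤ -1

/-- The genus `#E(Δ) - #V(Δ) + 1 + ∑ g(v)` of the subgraph `Δ` carried by a set `A`
(used for connected subgraphs). -/
def genusOn (A : Set Γ.X) : ℤ :=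
  (Nat.card {e : Γ.Edge // ∀ h ∈ e.1, h ∈ A} : ℤ) - (Nat.card {v : Γ.Vertex // v.1 ∈ A} : ℤ) + 1
    + ∑ᶠ v : {v : Γ.Vertex // v.1 ∈ A}, (Γ.w v.1 : ℤ)

/-- The genus of a (connected) weighted graph. -/
def genus : ℤ := Γ.genusOn Set.univ

/-- `f : Γ → Δ` is the weighted contraction of the set of edges `S`, up to isomorphism of the
target: it identifies `Δ` with the quotient of `Γ` in which every connected component of the
subgraph spanned by `S` becomes a vertex, and the weight of each vertex of `Δ` is the genus of the
subgraph of `Γ` contracted to it. -/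
structure IsContraction (Γ Δ : WGraph) (S : Set Γ.Edge) (f : Γ.X → Δ.X) : Prop where
  map_r : ∀ x, f (Γ.r x) = Δ.r (f x)
  map_inv : ∀ x, f (Γ.inv x) = Δ.inv (f x)
  surj : Function.Surjective f
  eq_iff : ∀ x y, f x = f y ↔ Relation.EqvGen (Γ.CollapseStep S) x y
  weight : ∀ u : Δ.Vertex, (Δ.w u : ℤ) = Γ.genusOn (f ⁻¹' {u.1})

end WGraph

/-! ## Harmonic morphisms and G-covers -/

/-- A finite harmonic morphism `Γs → Γ` with its degree function `d`. -/
structure Harmonic (Γs Γ : WGraph) where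
  φ : Γs.X → Γ.X
  map_r : ∀ x, φ (Γs.r x) = Γ.r (φ x)
  map_inv : ∀ x, φ (Γs.inv x) = Γ.inv (φ x)
  /-- edges map to edges -/
  map_edge : ∀ x, Γs.inv x ≠ x → Γ.inv (φ x) ≠ φ x
  /-- legs map to legs -/
  map_leg : ∀ x, ¬ Γs.IsVertex x → Γs.inv x = x → ¬ Γ.IsVertex (φ x)
  d : Γs.X → ℕ
  d_pos : ∀ x, 0 < d x
  d_inv : ∀ x, d (Γs.inv x) = d x
  harmonic : ∀ (v : Γs.Vertex) (h : Γ.X), ¬ Γ.IsVertex h → Γ.r h = φ v.1 →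
    d v.1 = ∑ᶠ x ∈ {x : Γs.X | ¬ Γs.IsVertex x ∧ Γs.r x = v.1 ∧ φ x = h}, d x

namespace Harmonic

variable {Γs Γ : WGraph} (f : Harmonic Γs Γ)

def onVertex (v : Γs.Vertex) : Γ.Vertex :=
  ⟨f.φ v.1, by
    have h := f.map_r v.1
    rw [show Γs.r v.1 = v.1 from v.2] at h
    exact h.symm⟩

def onEdge (e : Γs.Edge) : Γ.Edge :=
  ⟨Sym2.map f.φ e.1, by
    obtain ⟨h, hh, he⟩ := e.2
    exact ⟨f.φ h, f.map_edge h hh, by rw [he, Sym2.map_mk, f.map_inv]⟩⟩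

/-- The ramification degree at a vertex of the source. -/
def ram (v : Γs.Vertex) : ℤ := (f.d v.1 : ℤ) * Γ.chi (f.onVertex v) - Γs.chi v

def Unramified : Prop := ∀ v, f.ram v = 0

end Harmonic

/-- A `G`-cover of the weighted graph `Γ`: a finite harmonic morphism `Γs → Γ` with an action of
`G` on the weighted graph `Γs` that does not flip edges, leaves the harmonic morphism (with its
degrees) invariant and is transitive on its fibers, such that the degree of the morphism, that is
the sum of the local degrees over any vertex, is the order of `G`. -/
structure GCover (G : Type u) [Group G] (Γs Γ : WGraph) extends Harmonic Γs Γ where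
  act : G →* Equiv.Perm Γs.X
  act_r : ∀ a x, act a (Γs.r x) = Γs.r (act a x)
  act_inv : ∀ a x, act a (Γs.inv x) = Γs.inv (act a x)
  act_weight : ∀ a (v v₁ : Γs.Vertex), act a v.1 = v₁.1 → Γs.w v₁ = Γs.w v
  no_flip : ∀ a x, act a x = Γs.inv x → Γs.inv x = x
  invariant : ∀ a x, φ (act a x) = φ x
  d_invariant : ∀ a x, d (act a x) = d x
  transitive : ∀ x y, φ x = φ y → ∃ a, act a x = y
  degree : ∀ v : Γ.Vertex, ∑ᶠ x ∈ {x : Γs.X | φ x = v.1}, d x = Nat.card G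

/-! ## The category of marked unramified G-covers of stable graphs -/

variable (G : Type u) [Group G]

/-- The number `k` of legs of the source, for the ramification profile `μ`. -/
def numLegs {n : ℕ} (μ : Fin n → ℕ) : ℕ := ∑ i, Nat.card G / μ i

/-- The genus of the source: `(g - 1) #G + 1 + (n #G - k) / 2`. -/
def sourceGenus (g : ℕ) {n : ℕ} (μ : Fin n → ℕ) : ℤ :=
  ((g : ℤ) - 1) * Nat.card G + 1 + ((n : ℤ) * Nat.card G - numLegs G μ) / 2

/-- The objects of the category `J_{g,G}(μ)`. -/
structure Cover (g : ℕ) {n : ℕ} (μ : Fin n → ℕ) where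
  source : WGraph
  target : WGraph
  cover : GCover G source target
  unramified : cover.Unramified
  target_connected : target.Connected
  target_stable : target.Stable
  target_genus : target.genus = g
  source_connected : source.Connected
  source_stable : source.Stable
  source_genus : source.genus = sourceGenus G g μ
  mark : Fin n ≃ target.Leg
  sourceMark : (Σ i : Fin n, Fin (Nat.card G / μ i)) ≃ source.Leg
  mark_compat : ∀ i j, cover.φ (sourceMark ⟨i, j⟩).1 = (mark i).1

variable {G} {g n : ℕ} {μ : Fin n → ℕ}

/-- A pair of maps between sources and targets that is compatible with all the structure except
the weights and the degrees. Half-edges are allowed to be contracted to vertices. -/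
@[ext]
structure CoverMap (P Q : Cover G g μ) where
  src : P.source.X → Q.source.X
  tgt : P.target.X → Q.target.X
  src_r : ∀ x, src (P.source.r x) = Q.source.r (src x)
  src_inv : ∀ x, src (P.source.inv x) = Q.source.inv (src x)
  tgt_r : ∀ x, tgt (P.target.r x) = Q.target.r (tgt x)
  tgt_inv : ∀ x, tgt (P.target.inv x) = Q.target.inv (tgt x)
  comm : ∀ x, Q.cover.φ (src x) = tgt (P.cover.φ x)
  equivariant : ∀ a x, src (P.cover.act a x) = Q.cover.act a (src x)
  tgt_mark : ∀ i, tgt (P.mark i).1 = (Q.mark i).1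
  src_mark : ∀ p, src (P.sourceMark p).1 = (Q.sourceMark p).1

namespace CoverMap

variable {P Q R : Cover G g μ}

def id (P : Cover G g μ) : CoverMap P P where
  src x := x
  tgt x := x
  src_r _ := rfl
  src_inv _ := rfl
  tgt_r _ := rfl
  tgt_inv _ := rfl
  comm _ := rfl
  equivariant _ _ := rfl
  tgt_mark _ := rfl
  src_mark _ := rfl

def comp (c : CoverMap P Q) (c₁ : CoverMap Q R) : CoverMap P R where
  src x := c₁.src (c.src x)
  tgt x := c₁.tgt (c.tgt x)
  src_r x := by rw [c.src_r, c₁.src_r]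
  src_inv x := by rw [c.src_inv, c₁.src_inv]
  tgt_r x := by rw [c.tgt_r, c₁.tgt_r]
  tgt_inv x := by rw [c.tgt_inv, c₁.tgt_inv]
  comm x := by rw [c₁.comm, c.comm]
  equivariant a x := by rw [c.equivariant, c₁.equivariant]
  tgt_mark i := by rw [c.tgt_mark, c₁.tgt_mark]
  src_mark p := by rw [c.src_mark, c₁.src_mark]

/-- Isomorphisms of marked unramified `G`-covers. -/
structure IsIso (c : CoverMap P Q) : Prop where
  src_bij : Function.Bijective c.src
  tgt_bij : Function.Bijective c.tgt
  src_weight : ∀ (v : P.source.Vertex) (v₁ : Q.source.Vertex), c.src v.1 = v₁.1 →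
    Q.source.w v₁ = P.source.w v
  tgt_weight : ∀ (v : P.target.Vertex) (v₁ : Q.target.Vertex), c.tgt v.1 = v₁.1 →
    Q.target.w v₁ = P.target.w v
  degree : ∀ x, Q.cover.d (c.src x) = P.cover.d x

/-- `c` is the weighted edge contraction of `P` along a set `S` of edges of the target graph: the
target is contracted along `S`, the source along the preimage of `S`, the action, the morphism and
the markings are the induced ones (as `c` is a `CoverMap`), and the local degrees are those of the
restrictions of `P` to the contracted subgraphs. -/
structure IsContraction (S : Set P.target.Edge) (c : CoverMap P Q) : Prop where
  tgt : P.target.IsContraction Q.target S c.tgt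
  src : P.source.IsContraction Q.source (P.cover.onEdge ⁻¹' S) c.src
  degree : ∀ x, Q.cover.d (c.src x) =
    ∑ᶠ y ∈ {y : P.source.X | c.src y = c.src x ∧ P.cover.φ y = P.cover.φ x}, P.cover.d y

/-- The maps generated by isomorphisms and weighted edge contractions. -/
inductive Generated : ∀ {P Q : Cover G g μ}, CoverMap P Q → Prop
  | iso {P Q : Cover G g μ} (c : CoverMap P Q) : c.IsIso → Generated c
  | contraction {P Q : Cover G g μ} (S : Set P.target.Edge) (c : CoverMap P Q) :
      c.IsContraction S → Generated c
  | comp {P Q R : Cover G g μ} (c : CoverMap P Q) (c₁ : CoverMap Q R) :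
      Generated c → Generated c₁ → Generated (c.comp c₁)

theorem isIso_id (P : Cover G g μ) : (id P).IsIso where
  src_bij := Function.bijective_id
  tgt_bij := Function.bijective_id
  src_weight v v₁ h := by rw [show v = v₁ from Subtype.ext h]
  tgt_weight v v₁ h := by rw [show v = v₁ from Subtype.ext h]
  degree _ := rfl

end CoverMap

/-- The category `J_{g,G}(μ)`. -/
instance : Category.{0} (Cover G g μ) where
  Hom P Q := {c : CoverMap P Q // c.Generated}
  id P := ⟨CoverMap.id P, .iso _ (CoverMap.isIso_id P)⟩
  comp c c₁ := ⟨c.1.comp c₁.1, .comp _ _ c.2 c₁.2⟩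

/-! ## Rational polyhedral cones, face morphisms and generalized cone complexes -/

/-- A (sharp) rational polyhedral cone in `ℝ^ι`, with the integral structure given by `ℤ^ι`. -/
structure RPCone where
  ι : Type
  [finite : Finite ι]
  carrier : PointedCone ℝ (ι → ℝ)
  rational : ∃ s : Finset (ι → ℤ),
    carrier = PointedCone.hull ℝ ((fun (m : ι → ℤ) (i : ι) => (m i : ℝ)) '' (s : Set (ι → ℤ)))
  sharp : ∀ x ∈ carrier, -x ∈ carrier → x = 0

attribute [instance] RPCone.finite

/-- A linear map `ℝ^ι → ℝ^κ` that maps `ℤ^ι` to `ℤ^κ`. -/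
def IsIntegral {ι κ : Type} (A : (ι → ℝ) →ₗ[ℝ] (κ → ℝ)) : Prop :=
  ∀ m : ι → ℤ, ∃ l : κ → ℤ, A (fun i => (m i : ℝ)) = fun k => (l k : ℝ)

/-- A not necessarily proper face morphism of rational polyhedral cones: an isomorphism of
rational polyhedral cones (a bijection such that it and its inverse are restrictions of
integral linear maps) onto a face of the target. -/
def IsFaceMorphism {σ τ : RPCone} (f : σ.carrier → τ.carrier) : Prop :=
  ∃ (A : (σ.ι → ℝ) →ₗ[ℝ] (τ.ι → ℝ)) (B : (τ.ι → ℝ) →ₗ[ℝ] (σ.ι → ℝ)),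
    IsIntegral A ∧ IsIntegral B ∧ (∀ x, (f x).1 = A x.1) ∧ (∀ x, B (f x).1 = x.1) ∧
    (σ.carrier.map A).IsFaceOf τ.carrier

theorem IsFaceMorphism.id (σ : RPCone) : IsFaceMorphism (fun x : σ.carrier => x) :=
  ⟨LinearMap.id, LinearMap.id, fun m => ⟨m, rfl⟩, fun m => ⟨m, rfl⟩, fun _ => rfl, fun _ => rfl,
    by rw [PointedCone.map_id]⟩

theorem IsFaceMorphism.comp {σ τ ρ : RPCone} {f : σ.carrier → τ.carrier}
    {f₁ : τ.carrier → ρ.carrier} (hf : IsFaceMorphism f) (hf₁ : IsFaceMorphism f₁) :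
    IsFaceMorphism (fun x => f₁ (f x)) := by
  obtain ⟨A, B, hA, hB, hfA, hfB, hF⟩ := hf
  obtain ⟨A₁, B₁, hA₁, hB₁, hfA₁, hfB₁, hF₁⟩ := hf₁
  refine ⟨A₁ ∘ₗ A, B ∘ₗ B₁, fun m => ?_, fun m => ?_, fun x => ?_, fun x => ?_, ?_⟩
  · obtain ⟨l, hl⟩ := hA m
    obtain ⟨k, hk⟩ := hA₁ l
    exact ⟨k, by rw [LinearMap.comp_apply, hl, hk]⟩
  · obtain ⟨l, hl⟩ := hB₁ m
    obtain ⟨k, hk⟩ := hB l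
    exact ⟨k, by rw [LinearMap.comp_apply, hl, hk]⟩
  · rw [hfA₁, hfA, LinearMap.comp_apply]
  · rw [LinearMap.comp_apply, hfB₁, hfB]
  · have key : ((σ.carrier.map A).map A₁).IsFaceOf (τ.carrier.map A₁) := by
      refine ⟨Set.image_mono hF.le, ?_⟩
      rintro _ _ a ⟨x, hx, rfl⟩ ⟨y, hy, rfl⟩ ha ⟨p, hp, hpe⟩
      have hinj : ∀ q ∈ τ.carrier, B₁ (A₁ q) = q := fun q hq => by
        have := hfB₁ ⟨q, hq⟩
        rwa [hfA₁] at this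
      have hsum : a • x + y ∈ τ.carrier := τ.carrier.add_mem (τ.carrier.smul_mem ha.le hx) hy
      have : p = a • x + y := by
        rw [← hinj p (hF.le hp), ← hinj _ hsum]
        congr 1
        simpa using hpe
      subst this
      exact ⟨x, hF.mem_of_smul_add_mem hx hy ha hp, rfl⟩
    rw [← PointedCone.map_map]
    exact key.trans hF₁

/-- The category of rational polyhedral cones with (not necessarily proper) face morphisms. -/
instance : Category.{0} RPCone where
  Hom σ τ := {f : σ.carrier → τ.carrier // IsFaceMorphism f}
  id σ := ⟨fun x => x, .id σ⟩
  comp f f₁ := ⟨fun x => f₁.1 (f.1 x), f.2.comp f₁.2⟩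

/-- The maps `π i` present the topological space `X` as a generalized cone complex: `X` is the
colimit (as a topological space) of a diagram `F` of rational polyhedral cones with face
morphisms, where the index category is finite up to equivalence. The clauses say that `π` is a
cocone, that the induced map from the quotient of the disjoint union of the cones by the
equivalence relation generated by the diagram is surjective and injective, and that `X` carries
the quotient topology. -/
structure IsGeneralizedConeComplex {I : Type v} [Category.{w} I] (F : I ⥤ RPCone) {X : Type z}
    [TopologicalSpace X] (π : ∀ i, (F.obj i).carrier → X) : Prop where
  finite_isoClasses : Finite (Quotient (isIsomorphicSetoid I))
  finite_hom : ∀ i j : I, Finite (i ⟶ j)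
  compat : ∀ {i j : I} (m : i ⟶ j) (a : (F.obj i).carrier), π j ((F.map m).1 a) = π i a
  surj : ∀ x, ∃ i a, π i a = x
  inj : ∀ (p q : Σ i, (F.obj i).carrier), π p.1 p.2 = π q.1 q.2 →
    Relation.EqvGen
      (fun p q : Σ i, (F.obj i).carrier => ∃ m : p.1 ⟶ q.1, q.2 = (F.map m).1 p.2) p q
  isOpen_iff : ∀ U : Set X, IsOpen U ↔ ∀ i, IsOpen (π i ⁻¹' U)

/-! ## The diagram of cones -/

/-- The cone `ℝ_{≥0}^E`. -/
abbrev orthant (E : Type) [Finite E] : RPCone where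
  ι := E
  carrier := PointedCone.positive ℝ (E → ℝ)
  rational := by
    classical
    have := Fintype.ofFinite E
    refine ⟨Finset.univ.image fun e : E => Pi.single e (1 : ℤ), ?_⟩
    apply le_antisymm
    · intro x hx
      rw [PointedCone.mem_positive] at hx
      have hsum : x = ∑ e, x e • (fun i => ((Pi.single e (1 : ℤ) : E → ℤ) i : ℝ)) := by
        ext i
        simp [Finset.sum_apply, Pi.single_apply]
      rw [hsum]
      refine Submodule.sum_mem _ fun e _ => ?_
      exact PointedCone.smul_mem _ (hx e) (PointedCone.subset_hull ⟨_, by simp, rfl⟩)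
    · refine Submodule.span_le.2 ?_
      rintro _ ⟨m, hm, rfl⟩
      simp only [Finset.coe_image, Finset.coe_univ, Set.image_univ, Set.mem_range] at hm
      obtain ⟨e, rfl⟩ := hm
      intro i
      by_cases h : i = e <;> simp [h]
  sharp x hx hx₁ := by
    rw [PointedCone.mem_positive] at hx hx₁
    exact le_antisymm (neg_nonneg.1 hx₁) hx

/-- The cone `σ_φ` of a cover. -/
abbrev Cover.cone (P : Cover G g μ) : RPCone := orthant P.target.Edge

namespace CoverMap

variable {P Q R : Cover G g μ}

open Classical in
/-- Transport of coordinates along a map of covers: an edge of `P` that maps to an edge of `Q` gets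
the coordinate of its image, an edge of `P` that is contracted gets the coordinate zero. -/
def extend (c : CoverMap P Q) : (Q.target.Edge → ℝ) →ₗ[ℝ] (P.target.Edge → ℝ) where
  toFun a e :=
    if h : ∃ x, Q.target.inv x ≠ x ∧ Sym2.map c.tgt e.1 = s(x, Q.target.inv x)
      then a ⟨Sym2.map c.tgt e.1, h⟩ else 0
  map_add' a b := by
    ext e
    simp only [Pi.add_apply]
    split_ifs
    · rfl
    · exact (add_zero _).symm
  map_smul' t a := by
    ext e
    simp only [Pi.smul_apply, RingHom.id_apply]
    split_ifs
    · rfl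
    · exact (smul_zero _).symm

theorem extend_nonneg (c : CoverMap P Q) {a : Q.target.Edge → ℝ} (ha : 0 ≤ a) :
    0 ≤ c.extend a := by
  intro e
  simp only [extend, LinearMap.coe_mk, AddHom.coe_mk, Pi.zero_apply]
  split_ifs with h
  · exact ha _
  · exact le_rfl

theorem extend_apply_of_eq (c : CoverMap P Q) (a : Q.target.Edge → ℝ) (e : P.target.Edge)
    (e₁ : Q.target.Edge) (h : Sym2.map c.tgt e.1 = e₁.1) : c.extend a e = a e₁ := by
  have h₁ : ∃ x, Q.target.inv x ≠ x ∧ Sym2.map c.tgt e.1 = s(x, Q.target.inv x) := h ▸ e₁.2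
  simp only [extend, LinearMap.coe_mk, AddHom.coe_mk, dif_pos h₁]
  congr 1
  exact Subtype.ext h

theorem extend_apply_of_ne (c : CoverMap P Q) (a : Q.target.Edge → ℝ) (e : P.target.Edge)
    (h : ∀ e₁ : Q.target.Edge, Sym2.map c.tgt e.1 ≠ e₁.1) : c.extend a e = 0 := by
  have h₁ : ¬ ∃ x, Q.target.inv x ≠ x ∧ Sym2.map c.tgt e.1 = s(x, Q.target.inv x) :=
    fun h₁ => h ⟨_, h₁⟩ rfl
  simp only [extend, LinearMap.coe_mk, AddHom.coe_mk, dif_neg h₁]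

theorem extend_id (P : Cover G g μ) (a : P.target.Edge → ℝ) : (id P).extend a = a := by
  ext e
  refine extend_apply_of_eq _ _ _ _ ?_
  rw [show (id P).tgt = _root_.id from rfl, Sym2.map_id, _root_.id]

theorem extend_comp (c : CoverMap P Q) (c₁ : CoverMap Q R) (a : R.target.Edge → ℝ) :
    (c.comp c₁).extend a = c.extend (c₁.extend a) := by
  ext e
  have hmap : Sym2.map (c.comp c₁).tgt e.1 = Sym2.map c₁.tgt (Sym2.map c.tgt e.1) := by
    rw [Sym2.map_map]; rfl
  by_cases h : ∃ e₁ : Q.target.Edge, Sym2.map c.tgt e.1 = e₁.1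
  · obtain ⟨e₁, h₁⟩ := h
    rw [extend_apply_of_eq c _ e e₁ h₁]
    rw [h₁] at hmap
    by_cases h₂ : ∃ e₂ : R.target.Edge, Sym2.map c₁.tgt e₁.1 = e₂.1
    · obtain ⟨e₂, h₂⟩ := h₂
      rw [extend_apply_of_eq c₁ _ e₁ e₂ h₂, extend_apply_of_eq _ _ e e₂ (hmap.trans h₂)]
    · push Not at h₂
      rw [extend_apply_of_ne c₁ _ e₁ h₂, extend_apply_of_ne _ _ e (by simpa [hmap] using h₂)]
  · push Not at h
    rw [extend_apply_of_ne c _ e h]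
    refine extend_apply_of_ne _ _ e fun e₂ he₂ => ?_
    obtain ⟨x, hx, hxe⟩ := e.2
    have hmx : Sym2.map c.tgt e.1 = s(c.tgt x, Q.target.inv (c.tgt x)) := by
      rw [hxe, Sym2.map_mk, c.tgt_inv]
    refine h ⟨_, c.tgt x, fun hc => ?_, hmx⟩ rfl
    obtain ⟨y, hy, hye⟩ := e₂.2
    rw [hmap, hxe, Sym2.map_mk, Sym2.map_mk, c.tgt_inv, hc, hye] at he₂
    rcases Sym2.eq_iff.1 he₂ with ⟨h₁, h₂⟩ | ⟨h₁, h₂⟩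
    · exact hy (h₂.symm.trans h₁)
    · exact hy (h₁.symm.trans h₂)

theorem IsContraction.collapse {S : Set P.target.Edge} {c : CoverMap P Q} (hc : c.IsContraction S)
    {x y : P.target.X} (h : Relation.EqvGen (P.target.CollapseStep S) x y) :
    x = y ∨ Q.target.inv (c.tgt x) = c.tgt x := by
  have hS : ∀ x, (∃ e ∈ S, x ∈ e.1) → Q.target.inv (c.tgt x) = c.tgt x := fun x hx => by
    rw [← c.tgt_inv]
    exact (hc.tgt.eq_iff _ _).2 (.symm _ _ (.rel _ _ ⟨hx, Or.inr rfl⟩))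
  induction h with
  | rel x y h => exact Or.inr (hS x h.1)
  | refl x => exact Or.inl rfl
  | symm x y h ih =>
    rcases ih with ih | ih
    · exact Or.inl ih.symm
    · exact Or.inr ((hc.tgt.eq_iff _ _).2 h ▸ ih)
  | trans x y t hxy hyt ih₁ ih₂ =>
    rcases ih₁ with rfl | ih₁
    · exact ih₂
    · exact Or.inr ih₁

theorem existsUnique_edge_of_inj {c : CoverMap P Q} (hs : Function.Surjective c.tgt)
    (hi : ∀ x y, c.tgt x = c.tgt y → x = y ∨ Q.target.inv (c.tgt x) = c.tgt x)
    (e₁ : Q.target.Edge) : ∃! e : P.target.Edge, Sym2.map c.tgt e.1 = e₁.1 := by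
  obtain ⟨y, hy, hye⟩ := e₁.2
  obtain ⟨x, rfl⟩ := hs y
  have hx : P.target.inv x ≠ x := fun h => hy (by rw [← c.tgt_inv, h])
  refine ⟨⟨s(x, P.target.inv x), x, hx, rfl⟩, ?_, ?_⟩
  · change Sym2.map c.tgt s(x, P.target.inv x) = _
    rw [hye, Sym2.map_mk, c.tgt_inv]
  rintro ⟨e, t, ht, rfl⟩ he
  rw [hye, Sym2.map_mk, ← c.tgt_inv] at he
  apply Subtype.ext
  rcases Sym2.eq_iff.1 he with ⟨h₁, -⟩ | ⟨h₁, h₂⟩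
  · rcases hi x t h₁.symm with rfl | h
    · rfl
    · exact absurd h hy
  · rcases hi x _ h₂.symm with h | h
    · change s(t, P.target.inv t) = s(x, P.target.inv x)
      rw [h, P.target.inv_inv]; exact Sym2.eq_swap
    · exact absurd h hy

theorem Generated.existsUnique_edge {P Q : Cover G g μ} {c : CoverMap P Q} (hc : c.Generated) :
    ∀ e₁ : Q.target.Edge, ∃! e : P.target.Edge, Sym2.map c.tgt e.1 = e₁.1 := by
  induction hc with
  | iso c h =>
    exact existsUnique_edge_of_inj h.tgt_bij.2 fun x y hxy => Or.inl (h.tgt_bij.1 hxy)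
  | contraction S c h =>
    exact existsUnique_edge_of_inj h.tgt.surj fun x y hxy => h.collapse ((h.tgt.eq_iff _ _).1 hxy)
  | @comp P Q R c c₁ _ _ ih ih₁ =>
    intro e₂
    obtain ⟨e₁, h₁, hu₁⟩ := ih₁ e₂
    obtain ⟨e, h, hu⟩ := ih e₁
    have hmap : ∀ e : P.target.Edge,
        Sym2.map (c.comp c₁).tgt e.1 = Sym2.map c₁.tgt (Sym2.map c.tgt e.1) := fun e => by
      rw [Sym2.map_map]; rfl
    refine ⟨e, by simp only [hmap, h, h₁], fun t ht => ?_⟩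
    simp only [hmap] at ht
    have hedge : ∃ x, Q.target.inv x ≠ x ∧ Sym2.map c.tgt t.1 = s(x, Q.target.inv x) := by
      obtain ⟨x, hx, hxe⟩ := t.2
      refine ⟨c.tgt x, fun hc => ?_, by rw [hxe, Sym2.map_mk, c.tgt_inv]⟩
      obtain ⟨y, hy, hye⟩ := e₂.2
      rw [hxe, Sym2.map_mk, Sym2.map_mk, c.tgt_inv, hc, hye] at ht
      rcases Sym2.eq_iff.1 ht with ⟨h₁, h₂⟩ | ⟨h₁, h₂⟩
      · exact hy (h₂.symm.trans h₁)
      · exact hy (h₁.symm.trans h₂)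
    exact hu t (congrArg Subtype.val (hu₁ ⟨_, hedge⟩ ht))

/-- The map of cones `σ_Q → σ_P` induced by a map of covers `P → Q`. -/
def coneMap (c : CoverMap P Q) (a : Q.cone.carrier) : P.cone.carrier :=
  ⟨c.extend a.1, c.extend_nonneg a.2⟩

theorem isFaceMorphism_coneMap (c : CoverMap P Q) (hc : c.Generated) :
    IsFaceMorphism c.coneMap := by
  classical
  choose s hs hu using hc.existsUnique_edge
  let B : (P.target.Edge → ℝ) →ₗ[ℝ] (Q.target.Edge → ℝ) := LinearMap.funLeft ℝ ℝ s
  have hBA : ∀ a, B (c.extend a) = a := fun a => by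
    ext e₁
    exact extend_apply_of_eq c a _ _ (hs e₁)
  refine ⟨c.extend, B, fun m => ?_, fun m => ⟨fun e₁ => m (s e₁), rfl⟩, fun _ => rfl,
    fun x => hBA _, ?_, ?_⟩
  · have : ∀ e, ∃ l : ℤ, c.extend (fun i => (m i : ℝ)) e = l := fun e => by
      by_cases h : ∃ e₁ : Q.target.Edge, Sym2.map c.tgt e.1 = e₁.1
      · obtain ⟨e₁, h⟩ := h
        exact ⟨m e₁, extend_apply_of_eq _ _ _ _ h⟩
      · push Not at h
        exact ⟨0, by rw [extend_apply_of_ne _ _ _ h, Int.cast_zero]⟩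
    choose l hl using this
    exact ⟨l, funext hl⟩
  · rintro _ ⟨a, ha, rfl⟩
    exact c.extend_nonneg ha
  · rintro x y t hx hy ht ⟨a, ha, hae⟩
    refine ⟨B x, fun e₁ => hx (s e₁), ?_⟩
    ext e
    by_cases h : ∃ e₁ : Q.target.Edge, Sym2.map c.tgt e.1 = e₁.1
    · obtain ⟨e₁, h⟩ := h
      change c.extend (B x) e = x e
      rw [extend_apply_of_eq _ _ _ _ h]
      change x (s e₁) = x e
      rw [hu e₁ e h]
    · push Not at h
      change c.extend (B x) e = x e
      rw [extend_apply_of_ne _ _ _ h]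
      have h₀ : t * x e + y e = 0 := by
        have := congrFun hae e
        change c.extend a e = t * x e + y e at this
        rw [← this]
        exact extend_apply_of_ne c a e h
      have hxe : 0 ≤ x e := hx e
      have hye : 0 ≤ y e := hy e
      have : t * x e = 0 := by nlinarith [mul_nonneg ht.le hxe]
      exact ((mul_eq_zero.1 this).resolve_left ht.ne').symm

end CoverMap

variable (G g μ) in
/-- The diagram of cones `σ_φ = ℝ_{≥0}^{E(Γ)}` indexed by `J_{g,G}(μ)`. It is contravariant: a
contraction of `P` to `Q` embeds `σ_Q` as a face of `σ_P`. -/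
def coneFunctor : (Cover G g μ)ᵒᵖ ⥤ RPCone where
  obj P := P.unop.cone
  map c := ⟨c.unop.1.coneMap, c.unop.1.isFaceMorphism_coneMap c.unop.2⟩
  map_id _ := Subtype.ext (funext fun _ => Subtype.ext (CoverMap.extend_id _ _))
  map_comp _ _ := Subtype.ext (funext fun _ => Subtype.ext (CoverMap.extend_comp _ _ _))

/-! ## The moduli space -/

variable (G g μ) in
/-- A marked unramified `G`-cover of stable tropical curves. A stable tropical curve is given by
its stable (that is, minimal) model, a stable weighted graph with positive edge lengths, and the
cover dilates each edge by its degree. -/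
structure TropCover where
  graph : Cover G g μ
  len : graph.target.Edge → ℝ
  len_pos : ∀ e, 0 < len e
  sourceLen : graph.source.Edge → ℝ
  sourceLen_pos : ∀ e, 0 < sourceLen e
  dilation : ∀ (e : graph.source.Edge), ∀ h ∈ e.1,
    len (graph.cover.onEdge e) = graph.cover.d h * sourceLen e

/-- Isomorphism of marked unramified `G`-covers of stable tropical curves. -/
def TropCover.Iso (T U : TropCover G g μ) : Prop :=
  ∃ c : CoverMap T.graph U.graph, c.IsIso ∧
    (∀ (e : T.graph.target.Edge) (e₁ : U.graph.target.Edge),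
      Sym2.map c.tgt e.1 = e₁.1 → U.len e₁ = T.len e) ∧
    (∀ (e : T.graph.source.Edge) (e₁ : U.graph.source.Edge),
      Sym2.map c.src e.1 = e₁.1 → U.sourceLen e₁ = T.sourceLen e)

theorem TropCover.Iso.refl (T : TropCover G g μ) : T.Iso T := by
  refine ⟨CoverMap.id _, CoverMap.isIso_id _, fun e e₁ h => ?_, fun e e₁ h => ?_⟩
  · rw [show (CoverMap.id T.graph).tgt = _root_.id from rfl, Sym2.map_id] at h
    rw [show e = e₁ from Subtype.ext h]
  · rw [show (CoverMap.id T.graph).src = _root_.id from rfl, Sym2.map_id] at h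
    rw [show e = e₁ from Subtype.ext h]

theorem TropCover.Iso.symm {T U : TropCover G g μ} (h : T.Iso U) : U.Iso T := by
  obtain ⟨c, hc, h₁, h₂⟩ := h
  let s := Equiv.ofBijective _ hc.src_bij
  let t := Equiv.ofBijective _ hc.tgt_bij
  have hs : ∀ x, c.src (s.symm x) = x := s.apply_symm_apply
  have ht : ∀ x, c.tgt (t.symm x) = x := t.apply_symm_apply
  refine ⟨⟨s.symm, t.symm, fun x => ?_, fun x => ?_, fun x => ?_, fun x => ?_, fun x => ?_,
    fun a x => ?_, fun i => ?_, fun p => ?_⟩, ⟨s.symm.bijective, t.symm.bijective,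
    fun v v₁ h => ?_, fun v v₁ h => ?_, fun x => ?_⟩, fun e e₁ h => ?_, fun e e₁ h => ?_⟩
  · exact hc.src_bij.1 (by rw [c.src_r, hs, hs])
  · exact hc.src_bij.1 (by rw [c.src_inv, hs, hs])
  · exact hc.tgt_bij.1 (by rw [c.tgt_r, ht, ht])
  · exact hc.tgt_bij.1 (by rw [c.tgt_inv, ht, ht])
  · exact hc.tgt_bij.1 (by rw [← c.comm, hs, ht])
  · exact hc.src_bij.1 (by rw [c.equivariant, hs, hs])
  · exact hc.tgt_bij.1 (by rw [c.tgt_mark, ht])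
  · exact hc.src_bij.1 (by rw [c.src_mark, hs])
  · exact (hc.src_weight v₁ v (by rw [← h]; exact hs _)).symm
  · exact (hc.tgt_weight v₁ v (by rw [← h]; exact ht _)).symm
  · exact (hc.degree (s.symm x)).symm.trans (by rw [hs])
  · refine (h₁ e₁ e ?_).symm
    rw [← h, Sym2.map_map, show c.tgt ∘ t.symm = _root_.id from funext ht, Sym2.map_id, _root_.id]
  · refine (h₂ e₁ e ?_).symm
    rw [← h, Sym2.map_map, show c.src ∘ s.symm = _root_.id from funext hs, Sym2.map_id, _root_.id]

theorem TropCover.Iso.trans {T U W : TropCover G g μ} (h : T.Iso U) (k : U.Iso W) : T.Iso W := by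
  obtain ⟨c, hc, h₁, h₂⟩ := h
  obtain ⟨b, hb, k₁, k₂⟩ := k
  refine ⟨c.comp b, ⟨hb.src_bij.comp hc.src_bij, hb.tgt_bij.comp hc.tgt_bij,
    fun v v₁ h => ?_, fun v v₁ h => ?_, fun x => (hb.degree _).trans (hc.degree _)⟩,
    fun e e₁ h => ?_, fun e e₁ h => ?_⟩
  · have hv : U.graph.source.IsVertex (c.src v.1) := by
      change _ = _
      rw [← c.src_r, show T.graph.source.r v.1 = v.1 from v.2]
    exact (hb.src_weight ⟨_, hv⟩ v₁ h).trans (hc.src_weight v ⟨_, hv⟩ rfl)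
  · have hv : U.graph.target.IsVertex (c.tgt v.1) := by
      change _ = _
      rw [← c.tgt_r, show T.graph.target.r v.1 = v.1 from v.2]
    exact (hb.tgt_weight ⟨_, hv⟩ v₁ h).trans (hc.tgt_weight v ⟨_, hv⟩ rfl)
  · obtain ⟨x, hx, hxe⟩ := e.2
    have he : ∃ y, U.graph.target.inv y ≠ y ∧
        Sym2.map c.tgt e.1 = s(y, U.graph.target.inv y) :=
      ⟨c.tgt x, fun hh => hx (hc.tgt_bij.1 (by rw [c.tgt_inv, hh])),
        by rw [hxe, Sym2.map_mk, c.tgt_inv]⟩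
    exact (k₁ ⟨_, he⟩ e₁ (by rw [Sym2.map_map]; exact h)).trans (h₁ e ⟨_, he⟩ rfl)
  · obtain ⟨x, hx, hxe⟩ := e.2
    have he : ∃ y, U.graph.source.inv y ≠ y ∧
        Sym2.map c.src e.1 = s(y, U.graph.source.inv y) :=
      ⟨c.src x, fun hh => hx (hc.src_bij.1 (by rw [c.src_inv, hh])),
        by rw [hxe, Sym2.map_mk, c.src_inv]⟩
    exact (k₂ ⟨_, he⟩ e₁ (by rw [Sym2.map_map]; exact h)).trans (h₂ e ⟨_, he⟩ rfl)

variable (G g μ) in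
instance tropSetoid : Setoid (TropCover G g μ) where
  r := TropCover.Iso
  iseqv := ⟨TropCover.Iso.refl, TropCover.Iso.symm, TropCover.Iso.trans⟩

variable (G g μ) in
/-- The moduli space `H^trop_{g,G}(μ)`: isomorphism classes of marked unramified `G`-covers of
stable tropical curves. -/
def HTrop : Type (max 1 u) := Quotient (tropSetoid G g μ)

/-- `T` is the tropical cover obtained from the point `a` of the cone of `P`: contract the edges
with coordinate zero, and use the remaining coordinates as edge lengths on the target. -/
def Realizes (P : Cover G g μ) (a : P.cone.carrier) (T : TropCover G g μ) : Prop :=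
  ∃ c : CoverMap P T.graph, c.IsContraction {e | a.1 e = 0} ∧
    ∀ (e : P.target.Edge) (e₁ : T.graph.target.Edge),
      Sym2.map c.tgt e.1 = e₁.1 → T.len e₁ = a.1 e

end TropGCover

end

noncomputable section

namespace TropGCover

/-! ## Collapsing edges -/

/-! A point of a cone is a cover whose target edges carry nonnegative lengths, and its class in the
moduli space arises by contracting the edges of length zero. Three facts turn this into a colimit.

Contraction does not leave the category. Genera and valencies are encoded in one function on points,
`eulerWeight`: its sum over the points rooted at a vertex is minus the Euler characteristic there,
and the sum of its variant `genusWeight`, which ignores legs, is `2 g - 2`. Both are pushed forward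
by contractions (`sum_eulerWeight`, `sum_genusWeight`), so the genus is preserved and the Euler
characteristic is additive; hence stability and unramifiedness survive. The local degree at a
contracted component is the total degree over any one point of the component below it (`degOver`);
harmonicity makes it independent of that point (`degOver_eq_of_collapsed`). Action and markings
descend, which gives `Cover.contract`.

Contractions compose (`CoverMap.IsContraction.comp`), an isomorphism being a contraction of no
edges, and two contractions along the same edges differ by an isomorphism (`isIso_descend`). As
source lengths are forced by dilation, each point is realized by a unique class of tropical covers,
and face maps do not change this class (`Realizes.coneMap`). A tropical cover realizes its own
length vector, which gives surjectivity. Conversely, each point of a cone is the image of the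
positive length vector of its realization under a face map (`Realizes.exists_coneMap`), so points
with isomorphic realizations are linked by a zigzag of face maps.

Finiteness: stability lets each vertex contribute at least one to `2 g - 2` plus the number of legs.
This bounds the number of points and the weights, while degrees are at most the order of `G`. A
cover is thus determined up to isomorphism by a code in a finite set. -/

theorem finsum_mem_setOf_eq_sum_filter {α M : Type*} [AddCommMonoid M] [Fintype α] (p : α → Prop)
    [DecidablePred p] (f : α → M) : ∑ᶠ x ∈ {x | p x}, f x = ∑ x with p x, f x := by
  rw [← finsum_mem_coe_finset]
  simp

namespace LegGraph

variable {Γ : LegGraph} {S : Set Γ.Edge} {x y : Γ.X}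

instance (Γ : LegGraph) : Fintype Γ.X := Fintype.ofFinite _

theorem isVertex_r (x : Γ.X) : Γ.IsVertex (Γ.r x) := Γ.r_r x

theorem IsVertex.inv_eq (h : Γ.IsVertex x) : Γ.inv x = x := by
  rw [← show Γ.r x = x from h, Γ.inv_r]

theorem inv_ne_inv_inv (h : Γ.inv x ≠ x) : Γ.inv (Γ.inv x) ≠ Γ.inv x := by
  rw [Γ.inv_inv]; exact h.symm

theorem isVertex_inv_iff : Γ.IsVertex (Γ.inv x) ↔ Γ.IsVertex x := by
  constructor
  · intro h
    have := h.inv_eq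
    rw [Γ.inv_inv] at this
    rwa [this]
  · intro h
    rwa [h.inv_eq]

/-- The edge containing the half-edge `x`. -/
def edgeOf (x : Γ.X) (h : Γ.inv x ≠ x) : Γ.Edge := ⟨s(x, Γ.inv x), x, h, rfl⟩

theorem Edge.inv_ne_of_mem (e : Γ.Edge) (h : x ∈ e.1) : Γ.inv x ≠ x := by
  obtain ⟨t, ht, he⟩ := e.2
  rw [he, Sym2.mem_iff] at h
  rcases h with rfl | rfl
  · exact ht
  · exact inv_ne_inv_inv ht

theorem Edge.eq_edgeOf_of_mem (e : Γ.Edge) (h : x ∈ e.1) :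
    e = Γ.edgeOf x (e.inv_ne_of_mem h) := by
  apply Subtype.ext
  obtain ⟨t, ht, he⟩ := e.2
  rw [he, Sym2.mem_iff] at h
  rw [he]
  rcases h with rfl | rfl
  · rfl
  · change _ = s(Γ.inv t, Γ.inv (Γ.inv t))
    rw [Γ.inv_inv, Sym2.eq_swap]

theorem edgeOf_inv (h : Γ.inv x ≠ x) : Γ.edgeOf (Γ.inv x) (inv_ne_inv_inv h) = Γ.edgeOf x h :=
  ((Γ.edgeOf x h).eq_edgeOf_of_mem (Sym2.mem_mk_right _ _)).symm

/-- `x` is a half-edge of an edge in `S`. -/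
def InEdges (S : Set Γ.Edge) (x : Γ.X) : Prop := ∃ e ∈ S, x ∈ e.1

theorem inEdges_iff : InEdges S x ↔ ∃ h : Γ.inv x ≠ x, Γ.edgeOf x h ∈ S := by
  constructor
  · rintro ⟨e, he, hx⟩
    exact ⟨e.inv_ne_of_mem hx, e.eq_edgeOf_of_mem hx ▸ he⟩
  · rintro ⟨h, hS⟩
    exact ⟨_, hS, Sym2.mem_mk_left _ _⟩

theorem InEdges.inv_ne (h : InEdges S x) : Γ.inv x ≠ x := (inEdges_iff.1 h).1

theorem InEdges.not_isVertex (h : InEdges S x) : ¬ Γ.IsVertex x := fun hx => h.inv_ne hx.inv_eq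

theorem InEdges.inv (h : InEdges S x) : InEdges S (Γ.inv x) := by
  obtain ⟨h₁, h₂⟩ := inEdges_iff.1 h
  exact inEdges_iff.2 ⟨inv_ne_inv_inv h₁, by rwa [edgeOf_inv h₁]⟩

/-- The equivalence relation whose classes become the points of `Γ/S`. -/
abbrev Collapsed (S : Set Γ.Edge) : Γ.X → Γ.X → Prop := Relation.EqvGen (Γ.CollapseStep S)

theorem Collapsed.r_of_inEdges (h : InEdges S x) : Collapsed S x (Γ.r x) :=
  .rel _ _ ⟨h, Or.inl rfl⟩

theorem Collapsed.inv_of_inEdges (h : InEdges S x) : Collapsed S x (Γ.inv x) :=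
  .rel _ _ ⟨h, Or.inr rfl⟩

/-- A generating step starts at a half-edge in `S` and ends at a vertex or at a half-edge in `S`. So
legs and half-edges outside `S` are alone in their classes, which makes contractions injective off
the vertices of the quotient. -/
theorem Collapsed.eq_or (h : Collapsed S x y) :
    x = y ∨ ((Γ.IsVertex x ∨ InEdges S x) ∧ (Γ.IsVertex y ∨ InEdges S y)) := by
  induction h with
  | rel x y h =>
    obtain ⟨h, rfl | rfl⟩ := h
    · exact Or.inr ⟨Or.inr h, Or.inl (isVertex_r x)⟩
    · exact Or.inr ⟨Or.inr h, Or.inr (InEdges.inv h)⟩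
  | refl x => exact Or.inl rfl
  | symm x y _ ih => exact ih.imp Eq.symm And.symm
  | trans x y z _ _ ih₁ ih₂ =>
    rcases ih₁ with rfl | ih₁
    · exact ih₂
    · rcases ih₂ with rfl | ih₂
      · exact Or.inr ih₁
      · exact Or.inr ⟨ih₁.1, ih₂.2⟩

/-- A map respects the generated equivalence relations when it respects the generators. -/
theorem _root_.Relation.EqvGen.map_of_rel {α β : Type*} {p : α → α → Prop} {q : β → β → Prop}
    (f : α → β) (hf : ∀ x y, p x y → Relation.EqvGen q (f x) (f y)) {x y : α}
    (h : Relation.EqvGen p x y) : Relation.EqvGen q (f x) (f y) := by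
  induction h with
  | rel x y h => exact hf x y h
  | refl x => exact .refl _
  | symm x y _ ih => exact ih.symm
  | trans x y z _ _ ih₁ ih₂ => exact ih₁.trans _ _ _ ih₂

theorem Collapsed.map_r (h : Collapsed S x y) : Collapsed S (Γ.r x) (Γ.r y) := by
  refine Relation.EqvGen.map_of_rel Γ.r (fun x y h => ?_) h
  obtain ⟨h, rfl | rfl⟩ := h
  · rw [Γ.r_r]; exact .refl _
  · exact .trans _ _ _ (.symm _ _ (r_of_inEdges h))
      (.trans _ _ _ (inv_of_inEdges h) (r_of_inEdges (InEdges.inv h)))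

theorem Collapsed.map_inv (h : Collapsed S x y) : Collapsed S (Γ.inv x) (Γ.inv y) := by
  refine Relation.EqvGen.map_of_rel Γ.inv (fun x y h => ?_) h
  obtain ⟨h, rfl | rfl⟩ := h
  · rw [Γ.inv_r]
    exact .trans _ _ _ (.symm _ _ (inv_of_inEdges h)) (r_of_inEdges h)
  · rw [Γ.inv_inv]
    exact .symm _ _ (inv_of_inEdges h)

theorem collapsed_r_iff : Collapsed S x (Γ.r x) ↔ Γ.IsVertex x ∨ InEdges S x := by
  constructor
  · intro h
    rcases h.eq_or with h | h
    · exact Or.inl h.symm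
    · exact h.1
  · rintro (h | h)
    · rw [show Γ.r x = x from h]; exact .refl _
    · exact .r_of_inEdges h

variable (S) in
/-- The vertices in a class of collapsed points form a connected graph, whose edges come from the
edges in that class. -/
theorem card_vertex_le_card_edge_add_one (x₀ : Γ.X) :
    Nat.card {v : Γ.Vertex // Collapsed S x₀ v.1} ≤
      Nat.card {e : Γ.Edge // ∀ h ∈ e.1, Collapsed S x₀ h} + 1 := by
  classical
  let V := {v : Γ.Vertex // Collapsed S x₀ v.1}
  -- The class of a leg or of a half-edge outside `S` contains no vertex.
  rcases isEmpty_or_nonempty V with hV | hV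
  · rw [Nat.card_of_isEmpty]; exact Nat.zero_le _
  -- Loops and parallel edges are discarded. This can only lower the number of edges, so the bound
  -- for connected simple graphs suffices.
  let H : SimpleGraph V :=
    { Adj := fun a b => a ≠ b ∧ ∃ h, InEdges S h ∧ Γ.r h = a.1.1 ∧ Γ.r (Γ.inv h) = b.1.1
      symm := ⟨fun a b ⟨hab, h, hS, h₁, h₂⟩ =>
        ⟨hab.symm, Γ.inv h, hS.inv, h₂, by rw [Γ.inv_inv, h₁]⟩⟩
      loopless := ⟨fun a h => h.1 rfl⟩ }
  have key : ∀ x y, Collapsed S x y → ∀ (hx : Collapsed S x₀ (Γ.r x))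
      (hy : Collapsed S x₀ (Γ.r y)),
      H.Reachable ⟨⟨Γ.r x, isVertex_r x⟩, hx⟩ ⟨⟨Γ.r y, isVertex_r y⟩, hy⟩ := by
    intro x y h
    induction h with
    | rel x y h =>
      intro hx hy
      obtain ⟨h, rfl | rfl⟩ := h
      · have : (⟨⟨Γ.r x, isVertex_r x⟩, hx⟩ : V) = ⟨⟨Γ.r (Γ.r x), isVertex_r _⟩, hy⟩ :=
          Subtype.ext (Subtype.ext (Γ.r_r x).symm)
        rw [this]
      · by_cases heq : (⟨⟨Γ.r x, isVertex_r x⟩, hx⟩ : V) = ⟨⟨Γ.r (Γ.inv x), isVertex_r _⟩, hy⟩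
        · rw [heq]
        · exact SimpleGraph.Adj.reachable ⟨heq, x, h, rfl, rfl⟩
    | refl x => intro _ _; rfl
    | symm x y _ ih => intro hx hy; exact (ih hy hx).symm
    | trans x y z hxy _ ih₁ ih₂ =>
      intro hx hz
      have hy := hx.trans _ _ _ (Collapsed.map_r hxy)
      exact (ih₁ hx hy).trans (ih₂ hy hz)
  have hconn : H.Connected := by
    refine ⟨fun a b => ?_⟩
    have h := key a.1.1 b.1.1 (a.2.symm.trans _ _ _ b.2)
    simp only [show Γ.r a.1.1 = a.1.1 from a.1.2, show Γ.r b.1.1 = b.1.1 from b.1.2] at h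
    exact h a.2 b.2
  refine hconn.card_vert_le_card_edgeSet_add_one.trans (Nat.add_le_add_right ?_ 1)
  have hex : ∀ e : H.edgeSet, ∃ E : {e : Γ.Edge // ∀ h ∈ e.1, Collapsed S x₀ h},
      Sym2.map Γ.r E.1.1 = Sym2.map (fun v : V => v.1.1) e.1 := by
    rintro ⟨e, he⟩
    induction e with
    | _ a b =>
      obtain ⟨-, h, hS, h₁, h₂⟩ := (SimpleGraph.mem_edgeSet _).1 he
      have ha : Collapsed S x₀ h :=
        a.2.trans _ _ _ (.symm _ _ (h₁ ▸ Collapsed.r_of_inEdges hS))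
      refine ⟨⟨Γ.edgeOf h hS.inv_ne, fun t ht => ?_⟩, ?_⟩
      · rcases Sym2.mem_iff.1 ht with rfl | rfl
        · exact ha
        · exact ha.trans _ _ _ (Collapsed.inv_of_inEdges hS)
      · change Sym2.map Γ.r s(h, Γ.inv h) = _
        rw [Sym2.map_mk, Sym2.map_mk, h₁, h₂]
  choose F hF using hex
  -- An edge of `H` is determined by its end points, which are the roots of the two halves of the
  -- chosen edge.
  refine Nat.card_le_card_of_injective F fun e e₁ h => ?_
  refine Subtype.ext (Sym2.map.injective (f := fun v : V => v.1.1)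
    (fun a b hab => Subtype.ext (Subtype.ext hab)) ?_)
  rw [← hF e, ← hF e₁, h]

end LegGraph

open LegGraph

/-! ### Weighted contractions of graphs -/

namespace WGraph

variable {Γ Δ : WGraph} {S : Set Γ.Edge} {f : Γ.X → Δ.X}

/-- Weights are natural numbers, so `collapse` truncates the genus of a component by `toNat`;
nonnegativity, a consequence of connectedness, shows that nothing is lost. -/
theorem genusOn_nonneg (S : Set Γ.Edge) (x₀ : Γ.X) : 0 ≤ Γ.genusOn {x | Collapsed S x₀ x} := by
  have h := card_vertex_le_card_edge_add_one S x₀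
  have h₁ : 0 ≤ ∑ᶠ v : {v : Γ.Vertex // v.1 ∈ {x | Collapsed S x₀ x}}, (Γ.w v.1 : ℤ) :=
    finsum_nonneg fun _ => Int.natCast_nonneg _
  unfold genusOn
  simp only [Set.mem_ofPred_eq] at h₁ ⊢
  omega

/-- The weighted contraction `Γ/S`. -/
def collapse (Γ : WGraph) (S : Set Γ.Edge) : WGraph where
  X := Quot (Γ.CollapseStep S)
  r := Quot.lift (fun x => Quot.mk _ (Γ.r x))
    fun _ _ h => Quot.eqvGen_sound (Collapsed.map_r (.rel _ _ h))
  inv := Quot.lift (fun x => Quot.mk _ (Γ.inv x))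
    fun _ _ h => Quot.eqvGen_sound (Collapsed.map_inv (.rel _ _ h))
  r_r := by rintro ⟨x⟩; exact congrArg (Quot.mk _) (Γ.r_r x)
  inv_inv := by rintro ⟨x⟩; exact congrArg (Quot.mk _) (Γ.inv_inv x)
  inv_r := by rintro ⟨x⟩; exact congrArg (Quot.mk _) (Γ.inv_r x)
  w u := (Γ.genusOn (Quot.mk (Γ.CollapseStep S) ⁻¹' {u.1})).toNat

theorem isContraction_collapse (Γ : WGraph) (S : Set Γ.Edge) :
    Γ.IsContraction (Γ.collapse S) S (Quot.mk _) where
  map_r _ := rfl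
  map_inv _ := rfl
  surj := Quot.mk_surjective
  eq_iff _ _ := Quot.eq
  weight := by
    rintro ⟨⟨x⟩, hx⟩
    refine Int.toNat_of_nonneg ?_
    have : Quot.mk (Γ.CollapseStep S) ⁻¹' {Quot.mk _ x} = {y | Collapsed S x y} := by
      ext y
      exact Quot.eq.trans ⟨fun h => h.symm, fun h => h.symm⟩
    change 0 ≤ Γ.genusOn (Quot.mk (Γ.CollapseStep S) ⁻¹' {Quot.mk _ x})
    rw [this]
    exact genusOn_nonneg S x

namespace IsContraction

variable {x y : Γ.X}

theorem isVertex_iff (hf : Γ.IsContraction Δ S f) :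
    Δ.IsVertex (f x) ↔ Γ.IsVertex x ∨ InEdges S x := by
  rw [← collapsed_r_iff]
  refine Iff.trans ?_ (hf.eq_iff _ _)
  rw [hf.map_r]
  exact eq_comm

theorem eq_of_not_isVertex (hf : Γ.IsContraction Δ S f) (hx : ¬ Δ.IsVertex (f x))
    (h : f x = f y) : x = y := by
  rcases Collapsed.eq_or ((hf.eq_iff _ _).1 h) with h | h
  · exact h
  · exact absurd (hf.isVertex_iff.2 h.1) hx

theorem not_isVertex (hf : Γ.IsContraction Δ S f) (hx : ¬ Δ.IsVertex (f x)) : ¬ Γ.IsVertex x :=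
  fun h => hx (hf.isVertex_iff.2 (Or.inl h))

theorem inv_eq_iff (hf : Γ.IsContraction Δ S f) (hx : ¬ Δ.IsVertex (f x)) :
    Δ.inv (f x) = f x ↔ Γ.inv x = x := by
  rw [← hf.map_inv]
  exact ⟨fun h => (hf.eq_of_not_isVertex hx h.symm).symm, fun h => congrArg f h⟩

theorem not_isVertex_of_leg (hf : Γ.IsContraction Δ S f) (h₁ : ¬ Γ.IsVertex x)
    (h₂ : Γ.inv x = x) : ¬ Δ.IsVertex (f x) := fun h => by
  rcases hf.isVertex_iff.1 h with h | h
  · exact h₁ h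
  · exact h.inv_ne h₂

theorem exists_vertex (hf : Γ.IsContraction Δ S f) (u : Δ.Vertex) :
    ∃ v : Γ.Vertex, f v.1 = u.1 := by
  obtain ⟨x, hx⟩ := hf.surj u.1
  exact ⟨⟨Γ.r x, isVertex_r x⟩, by rw [hf.map_r, hx]; exact u.2⟩

end IsContraction

end WGraph

/-! ## Euler characteristics and genera as sums over points -/

namespace WGraph

variable {Γ Δ : WGraph} {S : Set Γ.Edge} {f : Γ.X → Δ.X}

open Classical in
/-- The contribution of a point to the (negative) Euler characteristics of the vertices: `2 g(v) - 2`
for a vertex and `1` for a half-edge. -/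
def eulerWeight (Γ : WGraph) (x : Γ.X) : ℤ :=
  if h : Γ.IsVertex x then 2 * (Γ.w ⟨x, h⟩ : ℤ) - 2 else 1

open Classical in
/-- The contribution of a point to `2 g - 2`, where legs do not count. -/
def genusWeight (Γ : WGraph) (x : Γ.X) : ℤ :=
  if ¬ Γ.IsVertex x ∧ Γ.inv x = x then 0 else Γ.eulerWeight x

theorem eulerWeight_vertex (v : Γ.Vertex) : Γ.eulerWeight v.1 = 2 * (Γ.w v : ℤ) - 2 := by
  rw [eulerWeight, dif_pos v.2]

theorem eulerWeight_of_not_isVertex {x : Γ.X} (h : ¬ Γ.IsVertex x) : Γ.eulerWeight x = 1 := by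
  rw [eulerWeight, dif_neg h]

theorem genusWeight_of_isVertex {x : Γ.X} (h : Γ.IsVertex x) :
    Γ.genusWeight x = Γ.eulerWeight x := by
  rw [genusWeight, if_neg (fun h₁ => h₁.1 h)]

theorem genusWeight_of_inv_ne {x : Γ.X} (h : Γ.inv x ≠ x) : Γ.genusWeight x = 1 := by
  rw [genusWeight, if_neg (fun h₁ => h h₁.2), eulerWeight_of_not_isVertex fun h₁ => h h₁.inv_eq]

theorem genusWeight_of_leg {x : Γ.X} (h : ¬ Γ.IsVertex x) (h₁ : Γ.inv x = x) :
    Γ.genusWeight x = 0 := by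
  rw [genusWeight, if_pos ⟨h, h₁⟩]

open Classical in
-- The map from half-edges to edges is two-to-one, and closure under `inv` keeps both halves of an
-- edge inside `A`.
theorem two_mul_card_edge (A : Set Γ.X) (hA : ∀ x ∈ A, Γ.inv x ∈ A) :
    2 * Nat.card {e : Γ.Edge // ∀ h ∈ e.1, h ∈ A} =
      (Finset.univ.filter fun x => x ∈ A ∧ Γ.inv x ≠ x).card := by
  have := Fintype.ofFinite {e : Γ.Edge // ∀ h ∈ e.1, h ∈ A}
  let F : {x // x ∈ A ∧ Γ.inv x ≠ x} → {e : Γ.Edge // ∀ h ∈ e.1, h ∈ A} := fun x =>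
    ⟨Γ.edgeOf x.1 x.2.2, fun h hh => by
      rcases Sym2.mem_iff.1 hh with rfl | rfl
      · exact x.2.1
      · exact hA _ x.2.1⟩
  rw [← Fintype.card_subtype, ← Finset.card_univ,
    Finset.card_eq_sum_card_fiberwise (f := F) (t := Finset.univ) (fun _ _ => Finset.mem_univ _),
    Finset.sum_const_nat (m := 2), Finset.card_univ, Nat.card_eq_fintype_card, mul_comm]
  rintro ⟨e, heA⟩ -
  obtain ⟨h, hh, he⟩ := e.2
  have hhA : h ∈ A := heA h (by rw [he]; exact Sym2.mem_mk_left _ _)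
  have hset : (Finset.univ.filter fun x => F x = ⟨e, heA⟩) =
      {⟨h, hhA, hh⟩, ⟨Γ.inv h, hA _ hhA, inv_ne_inv_inv hh⟩} := by
    ext ⟨x, hx⟩
    simp only [Finset.mem_filter, Finset.mem_univ, true_and, Finset.mem_insert,
      Finset.mem_singleton, Subtype.mk.injEq]
    constructor
    · intro h₁
      have h₂ : s(x, Γ.inv x) = e.1 := congrArg (fun t => t.1.1) h₁
      have h₃ : x ∈ e.1 := h₂ ▸ Sym2.mem_mk_left _ _
      rw [he] at h₃
      exact Sym2.mem_iff.1 h₃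
    · intro h₁
      apply Subtype.ext
      refine (e.eq_edgeOf_of_mem ?_).symm
      rw [he]
      exact Sym2.mem_iff.2 h₁
  rw [hset, Finset.card_pair]
  intro h₁
  exact hh (congrArg Subtype.val h₁).symm

open Classical in
theorem sum_isVertex_filter (p : Γ.X → Prop) [Fintype {v : Γ.Vertex // p v.1}]
    (F : Γ.X → ℤ) :
    ∑ x with Γ.IsVertex x ∧ p x, F x = ∑ v : {v : Γ.Vertex // p v.1}, F v.1.1 := by
  refine (Finset.sum_bij (fun v _ => v.1.1) ?_ ?_ ?_ ?_).symm
  · intro v _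
    simpa using ⟨v.1.2, v.2⟩
  · intro v _ v₁ _ h
    exact Subtype.ext (Subtype.ext h)
  · intro x hx
    simp only [Finset.mem_filter, Finset.mem_univ, true_and] at hx
    exact ⟨⟨⟨x, hx.1⟩, hx.2⟩, Finset.mem_univ _, rfl⟩
  · intro v _
    rfl

open Classical in
-- This turns the genus into a sum over points, which can be regrouped along the fibers of a
-- contraction. The two halves of an edge, each of weight one, account for twice the edge, and a
-- vertex accounts for `2 g(v) - 2`.
theorem two_mul_genusOn (A : Set Γ.X) (hA : ∀ x ∈ A, Γ.inv x ∈ A) :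
    2 * Γ.genusOn A = 2 + ∑ x with x ∈ A, Γ.genusWeight x := by
  have hE := two_mul_card_edge A hA
  have h₁ : ∑ x with x ∈ A, Γ.genusWeight x =
      ∑ x with Γ.IsVertex x ∧ x ∈ A, Γ.genusWeight x +
        (Finset.univ.filter fun x => x ∈ A ∧ Γ.inv x ≠ x).card := by
    rw [Finset.card_filter, Nat.cast_sum, Finset.sum_filter, Finset.sum_filter,
      ← Finset.sum_add_distrib]
    refine Finset.sum_congr rfl fun x _ => ?_
    by_cases hx : x ∈ A
    · by_cases hv : Γ.IsVertex x
      · simp [hx, hv, hv.inv_eq]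
      · by_cases hi : Γ.inv x = x
        · simp [hx, hv, hi, genusWeight_of_leg hv hi]
        · simp [hx, hv, hi, genusWeight_of_inv_ne hi]
    · simp [hx]
  rw [h₁, sum_isVertex_filter, ← hE, genusOn, finsum_eq_sum_of_fintype, Nat.card_eq_fintype_card,
    Nat.card_eq_fintype_card (α := {v : Γ.Vertex // v.1 ∈ A})]
  have h₂ : ∑ v : {v : Γ.Vertex // v.1 ∈ A}, Γ.genusWeight v.1.1 =
      2 * ∑ v : {v : Γ.Vertex // v.1 ∈ A}, (Γ.w v.1 : ℤ)
        - 2 * Fintype.card {v : Γ.Vertex // v.1 ∈ A} := by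
    rw [Finset.mul_sum, ← Finset.card_univ, Finset.cast_card, Finset.mul_sum,
      ← Finset.sum_sub_distrib]
    refine Finset.sum_congr rfl fun v _ => ?_
    rw [genusWeight_of_isVertex v.1.2, eulerWeight_vertex]
    ring
  rw [h₂]
  push_cast
  ring

open Classical in
-- The fiber of the root map over `v` contains `v` itself besides the half-edges at `v`; it supplies
-- the term `2 g(v) - 2`.
theorem neg_chi (v : Γ.Vertex) : - Γ.chi v = ∑ x with Γ.r x = v.1, Γ.eulerWeight x := by
  have h : ∑ x with Γ.r x = v.1, Γ.eulerWeight x =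
      Γ.eulerWeight v.1 + (Finset.univ.filter fun x => ¬ Γ.IsVertex x ∧ Γ.r x = v.1).card := by
    rw [Finset.card_filter, Nat.cast_sum, Finset.sum_filter,
      show Γ.eulerWeight v.1 = ∑ x, if x = v.1 then Γ.eulerWeight x else 0 by simp,
      ← Finset.sum_add_distrib]
    refine Finset.sum_congr rfl fun x _ => ?_
    by_cases hx : Γ.IsVertex x
    · simp [hx, show Γ.r x = x from hx]
    · have hxv : x ≠ v.1 := fun h => hx (h ▸ v.2)
      simp [hx, hxv, eulerWeight_of_not_isVertex hx]
  rw [h, eulerWeight_vertex, chi, val, Nat.card_eq_fintype_card, Fintype.card_subtype]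
  ring

open Classical in
theorem sum_neg_chi (p : Γ.X → Prop) [Fintype {v : Γ.Vertex // p v.1}] :
    ∑ v : {v : Γ.Vertex // p v.1}, - Γ.chi v.1 = ∑ x with p (Γ.r x), Γ.eulerWeight x := by
  simp_rw [neg_chi]
  rw [← sum_isVertex_filter p fun t => ∑ x with Γ.r x = t, Γ.eulerWeight x,
    Finset.sum_comm' (t' := Finset.univ.filter fun x => p (Γ.r x)) (s' := fun x => {Γ.r x})]
  · simp
  · intro t x
    simp only [Finset.mem_filter, Finset.mem_univ, true_and, Finset.mem_singleton]
    constructor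
    · rintro ⟨⟨_, h⟩, rfl⟩
      exact ⟨rfl, h⟩
    · rintro ⟨rfl, h⟩
      exact ⟨⟨isVertex_r x, h⟩, rfl⟩

namespace IsContraction

theorem fiber_inv (hf : Γ.IsContraction Δ S f) {y : Δ.X} (hy : Δ.IsVertex y) (x : Γ.X)
    (hx : x ∈ f ⁻¹' {y}) : Γ.inv x ∈ f ⁻¹' {y} := by
  change f _ = y
  rw [hf.map_inv, show f x = y from hx, hy.inv_eq]

open Classical in
theorem fiber_eq_singleton (hf : Γ.IsContraction Δ S f) {x : Γ.X} (hx : ¬ Δ.IsVertex (f x)) :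
    (Finset.univ.filter fun t => f t = f x) = {x} := by
  ext t
  simp only [Finset.mem_filter, Finset.mem_univ, true_and, Finset.mem_singleton]
  exact ⟨fun h => (hf.eq_of_not_isVertex hx h.symm).symm, fun h => congrArg f h⟩

open Classical in
-- Over a vertex this restates that the weight of the contraction is a genus; over any other point
-- the fiber is a singleton.
theorem sum_genusWeight (hf : Γ.IsContraction Δ S f) (y : Δ.X) :
    ∑ x with f x = y, Γ.genusWeight x = Δ.genusWeight y := by
  by_cases hy : Δ.IsVertex y
  · have h := two_mul_genusOn _ (hf.fiber_inv hy)
    rw [← hf.weight ⟨y, hy⟩] at h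
    rw [genusWeight_of_isVertex hy, eulerWeight_vertex ⟨y, hy⟩, h]
    simp
  · obtain ⟨x, rfl⟩ := hf.surj y
    rw [hf.fiber_eq_singleton hy, Finset.sum_singleton]
    simp only [genusWeight, hf.inv_eq_iff hy, hy, hf.not_isVertex hy, eulerWeight, dif_neg,
      not_false_eq_true]

open Classical in
-- No leg is contracted to a vertex, so on the fiber of a vertex `eulerWeight` and `genusWeight`
-- coincide.
theorem sum_eulerWeight (hf : Γ.IsContraction Δ S f) (y : Δ.X) :
    ∑ x with f x = y, Γ.eulerWeight x = Δ.eulerWeight y := by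
  by_cases hy : Δ.IsVertex y
  · rw [← genusWeight_of_isVertex hy, ← hf.sum_genusWeight]
    refine Finset.sum_congr rfl fun x hx => ?_
    simp only [Finset.mem_filter, Finset.mem_univ, true_and] at hx
    subst hx
    rw [genusWeight, if_neg]
    rintro ⟨h₁, h₂⟩
    exact hf.not_isVertex_of_leg h₁ h₂ hy
  · obtain ⟨x, rfl⟩ := hf.surj y
    rw [hf.fiber_eq_singleton hy, Finset.sum_singleton,
      eulerWeight_of_not_isVertex hy, eulerWeight_of_not_isVertex (hf.not_isVertex hy)]

open Classical in
theorem sum_preimage {F : Γ.X → ℤ} {F₁ : Δ.X → ℤ} (h : ∀ y, ∑ x with f x = y, F x = F₁ y)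
    (p : Δ.X → Prop) : ∑ x with p (f x), F x = ∑ y with p y, F₁ y := by
  simp_rw [← h]
  rw [← Finset.sum_fiberwise_of_maps_to (g := f) (t := Finset.univ.filter p)]
  · refine Finset.sum_congr rfl fun y hy => Finset.sum_congr ?_ fun _ _ => rfl
    ext x
    simp only [Finset.mem_filter, Finset.mem_univ, true_and] at hy ⊢
    exact ⟨fun h => h.2, fun h => ⟨h ▸ hy, h⟩⟩
  · intro x hx
    simpa using hx

theorem genusOn_preimage (hf : Γ.IsContraction Δ S f) (B : Set Δ.X) (hB : ∀ y ∈ B, Δ.inv y ∈ B) :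
    Γ.genusOn (f ⁻¹' B) = Δ.genusOn B := by
  classical
  have h := two_mul_genusOn B hB
  have h₁ := two_mul_genusOn (f ⁻¹' B) fun x hx => by
    change f _ ∈ B
    rw [hf.map_inv]
    exact hB _ hx
  have h₂ := sum_preimage hf.sum_genusWeight fun y => y ∈ B
  simp only [Set.mem_preimage] at h₁
  omega

theorem genus_eq (hf : Γ.IsContraction Δ S f) : Γ.genus = Δ.genus :=
  hf.genusOn_preimage Set.univ fun _ _ => trivial

open Classical in
-- Up to sign, both sides sum `eulerWeight` over the points of `Γ` whose root lands on `u`, grouped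
-- once by image and once by root.
theorem chi_eq_sum (hf : Γ.IsContraction Δ S f) (u : Δ.Vertex) :
    Δ.chi u = ∑ v : {v : Γ.Vertex // f v.1 = u.1}, Γ.chi v.1 := by
  have h := sum_neg_chi (Γ := Γ) fun x => f x = u.1
  have h₁ := sum_preimage hf.sum_eulerWeight fun y => Δ.r y = u.1
  simp only [hf.map_r] at h
  rw [h₁, ← neg_chi, Finset.sum_neg_distrib] at h
  omega

theorem stable (hf : Γ.IsContraction Δ S f) (h : Γ.Stable) : Δ.Stable := by
  classical
  intro u
  obtain ⟨v, hv⟩ := hf.exists_vertex u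
  rw [hf.chi_eq_sum, Fintype.sum_eq_add_sum_compl (⟨v, hv⟩ : {v : Γ.Vertex // f v.1 = u.1})]
  have h₁ := h v
  have h₂ : ∑ i ∈ {(⟨v, hv⟩ : {v : Γ.Vertex // f v.1 = u.1})}ᶜ, Γ.chi i.1 ≤ 0 :=
    Finset.sum_nonpos fun i _ => by have := h i.1; omega
  change Γ.chi v + _ ≤ _
  omega

theorem connected (hf : Γ.IsContraction Δ S f) (h : Γ.Connected) : Δ.Connected := by
  refine ⟨h.1.map f, fun y y₁ => ?_⟩
  obtain ⟨x, rfl⟩ := hf.surj y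
  obtain ⟨x₁, rfl⟩ := hf.surj y₁
  refine Relation.EqvGen.map_of_rel f (fun a b hab => .rel _ _ ?_) (h.2 x x₁)
  rcases hab with rfl | rfl
  · exact Or.inl (hf.map_r a)
  · exact Or.inr (hf.map_inv a)

/-- The legs of a contraction. -/
def legEquiv (hf : Γ.IsContraction Δ S f) : Γ.Leg ≃ Δ.Leg :=
  Equiv.ofBijective
    (fun l => ⟨f l.1, hf.not_isVertex_of_leg l.2.1 l.2.2, by rw [← hf.map_inv, l.2.2]⟩) <| by
    constructor
    · intro l l₁ h
      exact Subtype.ext (hf.eq_of_not_isVertex (hf.not_isVertex_of_leg l.2.1 l.2.2)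
        (congrArg Subtype.val h))
    · rintro ⟨y, h₁, h₂⟩
      obtain ⟨x, rfl⟩ := hf.surj y
      exact ⟨⟨x, hf.not_isVertex h₁, (hf.inv_eq_iff h₁).1 h₂⟩, rfl⟩

end IsContraction

end WGraph

/-! ## Contracting harmonic morphisms and covers -/

namespace Harmonic

variable {Γs Γ Δs Δ : WGraph} (c : Harmonic Γs Γ) {S : Set Γ.Edge}

theorem inv_eq_iff (x : Γs.X) : Γ.inv (c.φ x) = c.φ x ↔ Γs.inv x = x :=
  ⟨fun h => by_contra fun h₁ => c.map_edge x h₁ h, fun h => by rw [← c.map_inv, h]⟩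

theorem isVertex_iff (x : Γs.X) : Γ.IsVertex (c.φ x) ↔ Γs.IsVertex x := by
  constructor
  · intro h
    by_contra h₁
    exact c.map_leg x h₁ ((c.inv_eq_iff x).1 h.inv_eq) h
  · intro h
    change _ = _
    rw [← c.map_r, show Γs.r x = x from h]

theorem inEdges_iff (x : Γs.X) : InEdges (c.onEdge ⁻¹' S) x ↔ InEdges S (c.φ x) := by
  rw [LegGraph.inEdges_iff, LegGraph.inEdges_iff]
  have key : ∀ (h : Γs.inv x ≠ x) (h₁ : Γ.inv (c.φ x) ≠ c.φ x),
      c.onEdge (Γs.edgeOf x h) = Γ.edgeOf (c.φ x) h₁ := fun h h₁ => by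
    apply Subtype.ext
    change Sym2.map c.φ s(x, Γs.inv x) = s(c.φ x, Γ.inv (c.φ x))
    rw [Sym2.map_mk, c.map_inv]
  constructor
  · rintro ⟨h, hS⟩
    exact ⟨c.map_edge x h, key h (c.map_edge x h) ▸ hS⟩
  · rintro ⟨h, hS⟩
    have h₁ : Γs.inv x ≠ x := fun h₁ => h ((c.inv_eq_iff x).2 h₁)
    exact ⟨h₁, by rw [Set.mem_preimage, key h₁ h]; exact hS⟩

theorem collapsed_map {x y : Γs.X} (h : Collapsed (c.onEdge ⁻¹' S) x y) :
    Collapsed S (c.φ x) (c.φ y) := by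
  refine Relation.EqvGen.map_of_rel c.φ (fun x y h => .rel _ _ ⟨(c.inEdges_iff x).1 h.1, ?_⟩) h
  rcases h.2 with rfl | rfl
  · exact Or.inl (c.map_r x)
  · exact Or.inr (c.map_inv x)

open Classical in
theorem d_eq_sum (v : Γs.X) (t : Γ.X) (ht : ¬ Γ.IsVertex t) (hv : c.φ v = Γ.r t) :
    c.d v = ∑ x with Γs.r x = v ∧ c.φ x = t, c.d x := by
  have hv₁ : Γs.IsVertex v := (c.isVertex_iff v).1 (hv ▸ isVertex_r t)
  rw [c.harmonic ⟨v, hv₁⟩ t ht hv.symm, finsum_mem_setOf_eq_sum_filter]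
  refine Finset.sum_congr (Finset.filter_congr fun x _ => ?_) fun _ _ => rfl
  refine ⟨fun h => h.2, fun h => ⟨fun h₁ => ht ?_, h⟩⟩
  rw [← h.2]
  exact (c.isVertex_iff x).2 h₁

theorem exists_halfEdge (v : Γs.X) (t : Γ.X) (ht : ¬ Γ.IsVertex t) (hv : c.φ v = Γ.r t) :
    ∃ x, Γs.r x = v ∧ c.φ x = t := by
  classical
  have h := c.d_pos v
  rw [c.d_eq_sum v t ht hv] at h
  obtain ⟨x, hx⟩ := Finset.nonempty_of_sum_ne_zero h.ne'
  simp only [Finset.mem_filter, Finset.mem_univ, true_and] at hx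
  exact ⟨x, hx⟩

/-- Path lifting inside contracted components. The only step that needs an argument goes from a root
back to a half-edge: positivity of the degree and harmonicity provide a half-edge above it. Both
directions are carried along so that the induction passes through symmetry. -/
theorem exists_collapsed_lift {s t : Γ.X} (h : Collapsed S s t) :
    (∀ x, c.φ x = s → ∃ y, Collapsed (c.onEdge ⁻¹' S) x y ∧ c.φ y = t) ∧
    (∀ x, c.φ x = t → ∃ y, Collapsed (c.onEdge ⁻¹' S) x y ∧ c.φ y = s) := by
  induction h with
  | rel s t h =>
    obtain ⟨h, ht⟩ := h
    replace h : InEdges S s := h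
    rcases ht with rfl | rfl
    · refine ⟨?_, fun x hx => ?_⟩
      · rintro x rfl
        exact ⟨Γs.r x, .r_of_inEdges ((c.inEdges_iff x).2 h), c.map_r x⟩
      · obtain ⟨y, rfl, rfl⟩ := c.exists_halfEdge x s h.not_isVertex hx
        exact ⟨y, .symm _ _ (Collapsed.r_of_inEdges ((c.inEdges_iff y).2 h)), rfl⟩
    · refine ⟨?_, fun x hx => ?_⟩
      · rintro x rfl
        exact ⟨Γs.inv x, .inv_of_inEdges ((c.inEdges_iff x).2 h), c.map_inv x⟩
      · refine ⟨Γs.inv x, .inv_of_inEdges ((c.inEdges_iff x).2 (hx ▸ h.inv)), ?_⟩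
        rw [c.map_inv, hx, Γ.inv_inv]
  | refl s => exact ⟨fun x hx => ⟨x, .refl _, hx⟩, fun x hx => ⟨x, .refl _, hx⟩⟩
  | symm s t _ ih => exact ih.symm
  | trans s t r _ _ ih₁ ih₂ =>
    constructor
    · intro x hx
      obtain ⟨y, hxy, hy⟩ := ih₁.1 x hx
      obtain ⟨z, hyz, hz⟩ := ih₂.1 y hy
      exact ⟨z, hxy.trans _ _ _ hyz, hz⟩
    · intro x hx
      obtain ⟨y, hxy, hy⟩ := ih₂.2 x hx
      obtain ⟨z, hyz, hz⟩ := ih₁.2 y hy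
      exact ⟨z, hxy.trans _ _ _ hyz, hz⟩

open Classical in
/-- The degree over `t` of the restriction of a harmonic morphism to a fiber of `fs`. -/
def degOver (fs : Γs.X → Δs.X) (u : Δs.X) (t : Γ.X) : ℕ := ∑ y with fs y = u ∧ c.φ y = t, c.d y

variable {fs : Γs.X → Δs.X} {f : Γ.X → Δ.X}

open Classical in
-- Harmonicity replaces the degree of each vertex above the root of `t` by the degrees of its
-- half-edges above `t`.
theorem degOver_r (u : Δs.X) (t : Γ.X) (ht : ¬ Γ.IsVertex t) :
    c.degOver fs u (Γ.r t) = ∑ x with fs (Γs.r x) = u ∧ c.φ x = t, c.d x := by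
  rw [degOver, Finset.sum_congr rfl (g := fun v => ∑ x with Γs.r x = v ∧ c.φ x = t, c.d x),
    Finset.sum_comm' (t' := Finset.univ.filter fun x => fs (Γs.r x) = u ∧ c.φ x = t)
      (s' := fun x => {Γs.r x})]
  · simp
  · intro v x
    simp only [Finset.mem_filter, Finset.mem_univ, true_and, Finset.mem_singleton]
    constructor
    · rintro ⟨⟨h₁, -⟩, rfl, h₃⟩
      exact ⟨rfl, h₁, h₃⟩
    · rintro ⟨rfl, h₁, rfl⟩
      exact ⟨⟨h₁, c.map_r x⟩, rfl, rfl⟩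
  · intro v hv
    simp only [Finset.mem_filter, Finset.mem_univ, true_and] at hv
    exact c.d_eq_sum v t ht hv.2

/-- The restriction of a harmonic morphism to a contracted component has a well-defined degree.
Passing to the root is harmonicity, since a contracted half-edge lies in the same fiber of `fs` as
its root. Passing to the other half of an edge is the bijection `inv`, which preserves degrees. -/
theorem degOver_eq_of_collapsed (hs : Γs.IsContraction Δs (c.onEdge ⁻¹' S) fs) (u : Δs.X)
    {s t : Γ.X} (h : Collapsed S s t) : c.degOver fs u s = c.degOver fs u t := by
  classical
  induction h with
  | rel s t h =>
    obtain ⟨h, ht⟩ := h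
    replace h : InEdges S s := h
    rcases ht with rfl | rfl
    · rw [degOver_r c u s h.not_isVertex, degOver]
      refine Finset.sum_congr (Finset.filter_congr fun x _ => and_congr_left ?_) fun _ _ => rfl
      rintro rfl
      rw [(hs.eq_iff _ _).2 (Collapsed.r_of_inEdges ((c.inEdges_iff x).2 h))]
    · refine Finset.sum_nbij' Γs.inv Γs.inv ?_ ?_ (fun x _ => Γs.inv_inv x)
        (fun x _ => Γs.inv_inv x) (fun x _ => (c.d_inv x).symm)
      · intro x hx
        simp only [Finset.mem_filter, Finset.mem_univ, true_and] at hx ⊢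
        obtain ⟨rfl, rfl⟩ := hx
        exact ⟨((hs.eq_iff _ _).2 (Collapsed.inv_of_inEdges ((c.inEdges_iff x).2 h))).symm,
          c.map_inv x⟩
      · intro x hx
        simp only [Finset.mem_filter, Finset.mem_univ, true_and] at hx ⊢
        obtain ⟨rfl, hx⟩ := hx
        refine ⟨((hs.eq_iff _ _).2 (Collapsed.inv_of_inEdges ((c.inEdges_iff x).2 ?_))).symm, ?_⟩
        · rw [hx]; exact h.inv
        · rw [c.map_inv, hx, Γ.inv_inv]
  | refl => rfl
  | symm _ _ _ ih => exact ih.symm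
  | trans _ _ _ _ _ ih₁ ih₂ => exact ih₁.trans ih₂

/-- The map between contractions that is induced by a harmonic morphism. -/
def contractMap (hs : Γs.IsContraction Δs (c.onEdge ⁻¹' S) fs) (f : Γ.X → Δ.X) (y : Δs.X) : Δ.X :=
  f (c.φ (Function.surjInv hs.surj y))

/-- The local degrees of a contracted harmonic morphism. -/
def contractDeg (hs : Γs.IsContraction Δs (c.onEdge ⁻¹' S) fs) (y : Δs.X) : ℕ :=
  c.degOver fs y (c.φ (Function.surjInv hs.surj y))

variable (hs : Γs.IsContraction Δs (c.onEdge ⁻¹' S) fs) (hf : Γ.IsContraction Δ S f)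
include hf

theorem contractMap_apply (x : Γs.X) : c.contractMap hs f (fs x) = f (c.φ x) :=
  (hf.eq_iff _ _).2 (c.collapsed_map ((hs.eq_iff _ _).1 (Function.surjInv_eq hs.surj (fs x))))

theorem contractDeg_eq (y : Δs.X) (t : Γ.X) (h : f t = c.contractMap hs f y) :
    c.contractDeg hs y = c.degOver fs y t :=
  c.degOver_eq_of_collapsed hs y ((hf.eq_iff _ _).1 h.symm)

theorem contractMap_isVertex_iff (y : Δs.X) :
    Δ.IsVertex (c.contractMap hs f y) ↔ Δs.IsVertex y := by
  obtain ⟨x, rfl⟩ := hs.surj y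
  rw [c.contractMap_apply hs hf, hs.isVertex_iff, hf.isVertex_iff, c.isVertex_iff, c.inEdges_iff]

theorem contractMap_r (y : Δs.X) : c.contractMap hs f (Δs.r y) = Δ.r (c.contractMap hs f y) := by
  obtain ⟨x, rfl⟩ := hs.surj y
  rw [← hs.map_r, c.contractMap_apply hs hf, c.contractMap_apply hs hf, c.map_r, hf.map_r]

theorem contractMap_inv (y : Δs.X) :
    c.contractMap hs f (Δs.inv y) = Δ.inv (c.contractMap hs f y) := by
  obtain ⟨x, rfl⟩ := hs.surj y
  rw [← hs.map_inv, c.contractMap_apply hs hf, c.contractMap_apply hs hf, c.map_inv, hf.map_inv]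

/-- Each component of the source surjects onto the component below it. Both surjectivity on
half-edges in the harmonic condition and transitivity of the action on fibers rest on this. -/
theorem contractMap_eq_lift {y : Δs.X} {t : Γ.X} (h : c.contractMap hs f y = f t) :
    ∃ x, fs x = y ∧ c.φ x = t := by
  obtain ⟨x, rfl⟩ := hs.surj y
  rw [c.contractMap_apply hs hf] at h
  obtain ⟨z, hz, rfl⟩ := (c.exists_collapsed_lift ((hf.eq_iff _ _).1 h)).1 x rfl
  exact ⟨z, ((hs.eq_iff _ _).2 hz).symm, rfl⟩

theorem contractDeg_of_not_isVertex (x : Γs.X) (h : ¬ Δs.IsVertex (fs x)) :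
    c.contractDeg hs (fs x) = c.d x := by
  classical
  rw [c.contractDeg_eq hs hf _ (c.φ x) (c.contractMap_apply hs hf x).symm, degOver,
    Finset.sum_eq_single x]
  · intro y hy hyx
    simp only [Finset.mem_filter, Finset.mem_univ, true_and] at hy
    exact absurd (hs.eq_of_not_isVertex h hy.1.symm).symm hyx
  · simp

/-- The harmonic morphism between contractions that is induced by a harmonic morphism. -/
def contract : Harmonic Δs Δ where
  φ := c.contractMap hs f
  map_r := c.contractMap_r hs hf
  map_inv := c.contractMap_inv hs hf
  map_edge y hy h := by
    have hv : ¬ Δs.IsVertex y := fun h => hy h.inv_eq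
    obtain ⟨x, rfl⟩ := hs.surj y
    have hv₁ := mt (c.contractMap_isVertex_iff hs hf _).1 hv
    rw [c.contractMap_apply hs hf] at h hv₁
    rw [hf.inv_eq_iff hv₁, c.inv_eq_iff, ← hs.inv_eq_iff hv] at h
    exact hy h
  map_leg y hy _ := mt (c.contractMap_isVertex_iff hs hf y).1 hy
  d := c.contractDeg hs
  d_pos y := by
    classical
    obtain ⟨x, rfl⟩ := hs.surj y
    rw [c.contractDeg_eq hs hf _ (c.φ x) (c.contractMap_apply hs hf x).symm, degOver]
    refine Finset.sum_pos (fun y _ => c.d_pos y) ⟨x, ?_⟩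
    simp
  d_inv y := by
    obtain ⟨x, rfl⟩ := hs.surj y
    by_cases h : Δs.IsVertex (fs x)
    · rw [h.inv_eq]
    · rw [← hs.map_inv, c.contractDeg_of_not_isVertex hs hf x h,
        c.contractDeg_of_not_isVertex hs hf, c.d_inv]
      rwa [hs.map_inv, isVertex_inv_iff]
  harmonic v h hh hr := by
    classical
    obtain ⟨t, rfl⟩ := hf.surj h
    rw [← hf.map_r] at hr
    rw [c.contractDeg_eq hs hf v.1 (Γ.r t) hr, c.degOver_r _ _ (hf.not_isVertex hh),
      finsum_mem_setOf_eq_sum_filter]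
    have hx : ∀ x, c.φ x = t → ¬ Δs.IsVertex (fs x) := by
      rintro x rfl
      rwa [← c.contractMap_isVertex_iff hs hf, c.contractMap_apply hs hf]
    -- Points above `t` survive the contraction, so `fs` matches them bijectively with the
    -- half-edges above `f t` and keeps their degrees.
    refine Finset.sum_bij (fun x _ => fs x) ?_ ?_ ?_ ?_
    · intro x hx₁
      simp only [Finset.mem_filter, Finset.mem_univ, true_and] at hx₁ ⊢
      exact ⟨hx x hx₁.2, by rw [← hs.map_r, hx₁.1],
        by rw [c.contractMap_apply hs hf, hx₁.2]⟩
    · intro x hx₁ y _ hxy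
      simp only [Finset.mem_filter, Finset.mem_univ, true_and] at hx₁
      exact hs.eq_of_not_isVertex (hx x hx₁.2) hxy
    · intro y hy
      simp only [Finset.mem_filter, Finset.mem_univ, true_and] at hy
      obtain ⟨x, rfl, hxt⟩ := c.contractMap_eq_lift hs hf hy.2.2
      exact ⟨x, by simpa using ⟨by rw [hs.map_r, hy.2.1], hxt⟩, rfl⟩
    · intro x hx₁
      simp only [Finset.mem_filter, Finset.mem_univ, true_and] at hx₁
      exact (c.contractDeg_of_not_isVertex hs hf x (hx x hx₁.2)).symm

/-- Expand the Euler characteristic below as a sum over the vertices of the contracted component.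
The degree at `u` equals the degree over each of these, so unramifiedness upstairs converts every
product into a sum of Euler characteristics of source vertices. Altogether each vertex of the source
component is counted once. -/
theorem contract_unramified (h : c.Unramified) : (c.contract hs hf).Unramified := by
  classical
  intro u
  have hd : ∀ v : {v : Γ.Vertex // f v.1 = ((c.contract hs hf).onVertex u).1},
      (((c.contract hs hf).d u.1 : ℕ) : ℤ) * Γ.chi v.1 =
        ∑ y : {y : Γs.Vertex // fs y.1 = u.1}, if c.onVertex y.1 = v.1 then Γs.chi y.1 else 0 := by
    rintro ⟨v, hv⟩
    change ((c.contractDeg hs u.1 : ℕ) : ℤ) * Γ.chi v = _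
    rw [c.contractDeg_eq hs hf u.1 v.1 hv, degOver, Nat.cast_sum, Finset.sum_mul]
    have hchi : ∀ y : Γs.Vertex, (c.d y.1 : ℤ) * Γ.chi (c.onVertex y) = Γs.chi y := fun y =>
      sub_eq_zero.1 (h y)
    rw [← Finset.sum_filter]
    refine (Finset.sum_bij (fun y _ => y.1.1) ?_ ?_ ?_ ?_).symm
    · rintro ⟨y, hy⟩ hy₁
      simp only [Finset.mem_filter, Finset.mem_univ, true_and] at hy₁ ⊢
      exact ⟨hy, congrArg Subtype.val hy₁⟩
    · intro y _ y₁ _ hyy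
      exact Subtype.ext (Subtype.ext hyy)
    · intro y hy
      simp only [Finset.mem_filter, Finset.mem_univ, true_and] at hy
      have hyv : Γs.IsVertex y := (c.isVertex_iff y).1 (hy.2 ▸ v.2)
      exact ⟨⟨⟨y, hyv⟩, hy.1⟩, by simpa using Subtype.ext hy.2, rfl⟩
    · rintro ⟨y, hy⟩ hy₁
      simp only [Finset.mem_filter, Finset.mem_univ, true_and] at hy₁
      rw [← hchi, hy₁]
  rw [ram, hf.chi_eq_sum, hs.chi_eq_sum, Finset.mul_sum, Finset.sum_congr rfl fun v _ => hd v,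
    Finset.sum_comm, sub_eq_zero]
  refine Finset.sum_congr rfl fun y _ => ?_
  have hy : f (c.onVertex y.1).1 = ((c.contract hs hf).onVertex u).1 := by
    change f (c.φ y.1.1) = c.contractMap hs f u.1
    exact (c.contractMap_apply hs hf y.1.1).symm.trans (congrArg _ y.2)
  rw [Finset.sum_eq_single ⟨c.onVertex y.1, hy⟩, if_pos rfl]
  · intro v _ hv
    rw [if_neg fun h => hv (Subtype.ext h.symm)]
  · simp

end Harmonic

/-! ### Contractions of `G`-covers -/

namespace GCover

variable {G : Type u} [Group G] {Γs Γ Δs Δ : WGraph} (c : GCover G Γs Γ) {S : Set Γ.Edge}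
  {fs : Γs.X → Δs.X} {f : Γ.X → Δ.X}

theorem isVertex_act_iff (a : G) (x : Γs.X) : Γs.IsVertex (c.act a x) ↔ Γs.IsVertex x := by
  rw [← c.isVertex_iff, c.invariant, c.isVertex_iff]

theorem eulerWeight_act (a : G) (x : Γs.X) : Γs.eulerWeight (c.act a x) = Γs.eulerWeight x := by
  by_cases h : Γs.IsVertex x
  · have h₁ := (c.isVertex_act_iff a x).2 h
    rw [WGraph.eulerWeight_vertex ⟨x, h⟩, WGraph.eulerWeight_vertex ⟨_, h₁⟩,
      c.act_weight a ⟨x, h⟩ ⟨_, h₁⟩ rfl]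
  · rw [WGraph.eulerWeight_of_not_isVertex h,
      WGraph.eulerWeight_of_not_isVertex (mt (c.isVertex_act_iff a x).1 h)]

theorem collapsed_act (a : G) {x y : Γs.X} (h : Collapsed (c.onEdge ⁻¹' S) x y) :
    Collapsed (c.onEdge ⁻¹' S) (c.act a x) (c.act a y) := by
  refine Relation.EqvGen.map_of_rel (c.act a) (fun x y h => .rel _ _ ⟨?_, ?_⟩) h
  · have h₁ := (c.inEdges_iff x).1 h.1
    rw [← c.invariant a x] at h₁
    exact (c.inEdges_iff _).2 h₁
  · rcases h.2 with rfl | rfl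
    · exact Or.inl (c.act_r a x)
    · exact Or.inr (c.act_inv a x)

variable (hs : Γs.IsContraction Δs (c.onEdge ⁻¹' S) fs) (hf : Γ.IsContraction Δ S f)

/-- The map on a contraction of the source that is induced by an element of `G`. -/
def contractActMap (a : G) (y : Δs.X) : Δs.X := fs (c.act a (Function.surjInv hs.surj y))

theorem contractActMap_apply (a : G) (x : Γs.X) :
    c.contractActMap hs a (fs x) = fs (c.act a x) :=
  (hs.eq_iff _ _).2 (c.collapsed_act a
    ((hs.eq_iff _ _).1 (Function.surjInv_eq hs.surj (fs x))))

/-- The action on a contraction of the source. -/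
def contractAct : G →* Equiv.Perm Δs.X :=
  MonoidHom.toHomPerm
    { toFun := c.contractActMap hs
      map_one' := funext fun y => by
        obtain ⟨x, rfl⟩ := hs.surj y
        rw [c.contractActMap_apply hs, map_one]
        rfl
      map_mul' := fun a b => funext fun y => by
        obtain ⟨x, rfl⟩ := hs.surj y
        change _ = c.contractActMap hs a (c.contractActMap hs b (fs x))
        simp only [c.contractActMap_apply hs, map_mul, Equiv.Perm.mul_apply] }

theorem contractAct_apply (a : G) (x : Γs.X) : c.contractAct hs a (fs x) = fs (c.act a x) :=
  c.contractActMap_apply hs a x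

open Classical in
theorem degOver_act (a : G) (y : Δs.X) (t : Γ.X) :
    c.degOver fs (c.contractAct hs a y) t = c.degOver fs y t := by
  refine (Finset.sum_bij (fun x _ => c.act a x) ?_ (fun x _ y _ h => (c.act a).injective h)
    ?_ fun x _ => (c.d_invariant a x).symm).symm
  · intro x hx
    simp only [Finset.mem_filter, Finset.mem_univ, true_and] at hx ⊢
    exact ⟨by rw [← hx.1, c.contractAct_apply], by rw [c.invariant, hx.2]⟩
  · intro x hx
    simp only [Finset.mem_filter, Finset.mem_univ, true_and] at hx
    obtain ⟨z, rfl⟩ := (c.act a).surjective x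
    refine ⟨z, ?_, rfl⟩
    rw [← c.contractAct_apply hs, c.invariant] at hx
    simpa using ⟨(c.contractAct hs a).injective hx.1, hx.2⟩

open Classical in
-- The weight is a pushforward from the uncontracted source, where `G` permutes the fibers and
-- preserves it. Invariance of the contracted genera follows.
theorem eulerWeight_contractAct (a : G) (y : Δs.X) :
    Δs.eulerWeight (c.contractAct hs a y) = Δs.eulerWeight y := by
  rw [← hs.sum_eulerWeight, ← hs.sum_eulerWeight]
  refine (Finset.sum_bij (fun x _ => c.act a x) ?_ (fun x _ y _ h => (c.act a).injective h)
    ?_ fun x _ => (c.eulerWeight_act a x).symm).symm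
  · intro x hx
    simp only [Finset.mem_filter, Finset.mem_univ, true_and] at hx ⊢
    rw [← hx, c.contractAct_apply]
  · intro x hx
    simp only [Finset.mem_filter, Finset.mem_univ, true_and] at hx
    obtain ⟨z, rfl⟩ := (c.act a).surjective x
    rw [← c.contractAct_apply hs] at hx
    exact ⟨z, by simpa using (c.contractAct hs a).injective hx, rfl⟩

/-- The cover between contractions that is induced by a `G`-cover. -/
def contract : GCover G Δs Δ where
  toHarmonic := c.toHarmonic.contract hs hf
  act := c.contractAct hs
  act_r a y := by
    obtain ⟨x, rfl⟩ := hs.surj y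
    rw [← hs.map_r, c.contractAct_apply, c.contractAct_apply, c.act_r, hs.map_r]
  act_inv a y := by
    obtain ⟨x, rfl⟩ := hs.surj y
    rw [← hs.map_inv, c.contractAct_apply, c.contractAct_apply, c.act_inv, hs.map_inv]
  act_weight a v v₁ h := by
    have h₁ := c.eulerWeight_contractAct hs a v.1
    rw [h, WGraph.eulerWeight_vertex, WGraph.eulerWeight_vertex] at h₁
    omega
  no_flip a y h := by
    obtain ⟨x, rfl⟩ := hs.surj y
    by_cases hv : Δs.IsVertex (fs x)
    · exact hv.inv_eq
    rw [hs.inv_eq_iff hv]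
    rw [c.contractAct_apply, ← hs.map_inv] at h
    refine c.no_flip a x (hs.eq_of_not_isVertex ?_ h.symm).symm
    rwa [hs.map_inv, isVertex_inv_iff]
  invariant a y := by
    obtain ⟨x, rfl⟩ := hs.surj y
    change c.contractMap hs f _ = c.contractMap hs f _
    rw [c.contractAct_apply, c.contractMap_apply hs hf, c.contractMap_apply hs hf, c.invariant]
  d_invariant a y := by
    obtain ⟨x, rfl⟩ := hs.surj y
    change c.contractDeg hs _ = c.contractDeg hs _
    rw [c.contractDeg_eq hs hf (fs x) (c.φ x) (c.contractMap_apply hs hf x).symm,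
      c.contractDeg_eq hs hf _ (c.φ x), c.degOver_act]
    rw [c.contractAct_apply, c.contractMap_apply hs hf, c.invariant]
  transitive y y₁ h := by
    obtain ⟨x, rfl⟩ := hs.surj y
    change c.contractMap hs f _ = c.contractMap hs f _ at h
    rw [c.contractMap_apply hs hf] at h
    obtain ⟨z, rfl, hz⟩ := c.contractMap_eq_lift hs hf h.symm
    obtain ⟨a, ha⟩ := c.transitive x z hz.symm
    exact ⟨a, by rw [c.contractAct_apply, ha]⟩
  degree v := by
    classical
    obtain ⟨t, ht⟩ := hf.exists_vertex v
    -- All contracted degrees are measured over the same vertex `t` above `v`, so they partition the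
    -- degree of `c` over `t`.
    rw [← c.degree t, finsum_mem_setOf_eq_sum_filter, finsum_mem_setOf_eq_sum_filter,
      ← Finset.sum_fiberwise_of_maps_to (g := fs)
        (t := Finset.univ.filter fun y => c.contractMap hs f y = v.1)]
    · refine Finset.sum_congr rfl fun y hy => ?_
      simp only [Finset.mem_filter, Finset.mem_univ, true_and] at hy
      change c.contractDeg hs y = _
      rw [c.contractDeg_eq hs hf y t.1 (ht.trans hy.symm), Harmonic.degOver, Finset.filter_filter]
      exact Finset.sum_congr (Finset.filter_congr fun x _ => and_comm) fun _ _ => rfl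
    · intro x hx
      simp only [Finset.mem_filter, Finset.mem_univ, true_and] at hx ⊢
      rw [c.contractMap_apply hs hf, hx, ht]

end GCover

namespace Cover

variable {G : Type u} [Group G] {g n : ℕ} {μ : Fin n → ℕ} (P : Cover G g μ)
  (S : Set P.target.Edge)

/-- The weighted edge contraction of a marked unramified `G`-cover. -/
def contract : Cover G g μ :=
  let hs := WGraph.isContraction_collapse P.source (P.cover.onEdge ⁻¹' S)
  let hf := WGraph.isContraction_collapse P.target S
  { source := P.source.collapse (P.cover.onEdge ⁻¹' S)
    target := P.target.collapse S
    cover := P.cover.contract hs hf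
    unramified := P.cover.contract_unramified hs hf P.unramified
    target_connected := hf.connected P.target_connected
    target_stable := hf.stable P.target_stable
    target_genus := hf.genus_eq.symm.trans P.target_genus
    source_connected := hs.connected P.source_connected
    source_stable := hs.stable P.source_stable
    source_genus := hs.genus_eq.symm.trans P.source_genus
    mark := P.mark.trans hf.legEquiv
    sourceMark := P.sourceMark.trans hs.legEquiv
    mark_compat := fun i j => (P.cover.contractMap_apply hs hf _).trans
      (congrArg _ (P.mark_compat i j)) }

/-- The canonical map from a cover to its contraction. -/
def contractionMap : CoverMap P (P.contract S) where
  src := Quot.mk _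
  tgt := Quot.mk _
  src_r _ := rfl
  src_inv _ := rfl
  tgt_r _ := rfl
  tgt_inv _ := rfl
  comm := P.cover.contractMap_apply (WGraph.isContraction_collapse _ _)
    (WGraph.isContraction_collapse _ _)
  equivariant a x := (P.cover.contractAct_apply (WGraph.isContraction_collapse _ _) a x).symm
  tgt_mark _ := rfl
  src_mark _ := rfl

theorem isContraction_contractionMap : (P.contractionMap S).IsContraction S where
  tgt := WGraph.isContraction_collapse _ _
  src := WGraph.isContraction_collapse _ _
  degree x := by
    classical
    rw [finsum_mem_setOf_eq_sum_filter]
    exact P.cover.contractDeg_eq (WGraph.isContraction_collapse _ _)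
      (WGraph.isContraction_collapse _ S) _ (P.cover.φ x)
      (P.cover.contractMap_apply (WGraph.isContraction_collapse _ _)
        (WGraph.isContraction_collapse _ S) x).symm

end Cover

/-! ## Composition and uniqueness of contractions -/

theorem LegGraph.Edge.exists_eq_edgeOf {Γ : LegGraph} (e : Γ.Edge) :
    ∃ (x : Γ.X) (h : Γ.inv x ≠ x), e = Γ.edgeOf x h := by
  obtain ⟨x, hx, he⟩ := e.2
  exact ⟨x, hx, Subtype.ext he⟩

theorem LegGraph.Collapsed.mono {Γ : LegGraph} {S S₁ : Set Γ.Edge}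
    (h : ∀ x, InEdges S x → InEdges S₁ x) {x y : Γ.X} (hxy : Collapsed S x y) :
    Collapsed S₁ x y :=
  Relation.EqvGen.map_of_rel id (fun _ _ hab => .rel _ _ ⟨h _ hab.1, hab.2⟩) hxy

namespace WGraph

variable {Γ Δ Θ : WGraph}

open Classical in
/-- An isomorphism is a contraction of the empty set of edges. -/
theorem isContraction_empty {S : Set Γ.Edge} (hS : ∀ x, ¬ InEdges S x) {f : Γ.X → Δ.X}
    (map_r : ∀ x, f (Γ.r x) = Δ.r (f x)) (map_inv : ∀ x, f (Γ.inv x) = Δ.inv (f x))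
    (bij : Function.Bijective f)
    (weight : ∀ (v : Γ.Vertex) (v₁ : Δ.Vertex), f v.1 = v₁.1 → Δ.w v₁ = Γ.w v) :
    Γ.IsContraction Δ S f where
  map_r := map_r
  map_inv := map_inv
  surj := bij.2
  eq_iff x y := by
    constructor
    · intro h
      rw [bij.1 h]
      exact .refl _
    · intro h
      induction h with
      | rel x y h => exact absurd h.1 (hS x)
      | refl => rfl
      | symm _ _ _ ih => exact ih.symm
      | trans _ _ _ _ _ ih₁ ih₂ => exact ih₁.trans ih₂
  weight u := by
    obtain ⟨x, hx⟩ := bij.2 u.1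
    have hxv : Γ.IsVertex x := bij.1 (by rw [map_r, hx]; exact u.2)
    have hset : f ⁻¹' {u.1} = {x} := by
      ext y
      rw [← hx]
      exact bij.1.eq_iff
    have h := two_mul_genusOn {x} (Γ := Γ) fun y hy => by
      rw [Set.mem_singleton_iff.1 hy, hxv.inv_eq]; rfl
    rw [Finset.sum_eq_single_of_mem x (by simp) fun y hy hyx => absurd (by simpa using hy) hyx,
      genusWeight_of_isVertex hxv, eulerWeight_vertex ⟨x, hxv⟩] at h
    rw [hset, weight ⟨x, hxv⟩ u hx]
    omega

/-- `S₂` is described through half-edges because `S` and `S₁` consist of edges of different graphs,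
and `f` need not send edges to edges. -/
theorem IsContraction.comp {S : Set Γ.Edge} {S₁ : Set Δ.Edge} {S₂ : Set Γ.Edge} {f : Γ.X → Δ.X}
    {f₁ : Δ.X → Θ.X} (hf : Γ.IsContraction Δ S f) (hf₁ : Δ.IsContraction Θ S₁ f₁)
    (h : ∀ x, InEdges S₂ x ↔ InEdges S x ∨ InEdges S₁ (f x)) :
    Γ.IsContraction Θ S₂ (fun x => f₁ (f x)) where
  map_r x := by rw [hf.map_r, hf₁.map_r]
  map_inv x := by rw [hf.map_inv, hf₁.map_inv]
  surj := hf₁.surj.comp hf.surj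
  eq_iff x y := by
    constructor
    · intro hxy
      -- Quantifying over all lifts of both end points lets transitivity pass through an arbitrary
      -- lift of the middle point.
      have key : ∀ u v, Collapsed S₁ u v → ∀ x y, f x = u → f y = v → Collapsed S₂ x y := by
        have base : ∀ x y, f x = f y → Collapsed S₂ x y := fun x y hxy =>
          Collapsed.mono (fun x hx => (h x).2 (Or.inl hx)) ((hf.eq_iff _ _).1 hxy)
        intro u v huv
        induction huv with
        | rel u v huv =>
          rintro x y rfl rfl
          have hx : InEdges S₂ x := (h x).2 (Or.inr huv.1)
          rcases huv.2 with h₁ | h₁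
          · rw [← hf.map_r] at h₁
            exact (Collapsed.r_of_inEdges hx).trans _ _ _ (base _ _ h₁.symm)
          · rw [← hf.map_inv] at h₁
            exact (Collapsed.inv_of_inEdges hx).trans _ _ _ (base _ _ h₁.symm)
        | refl u => rintro x y rfl h₁; exact base _ _ h₁.symm
        | symm u v _ ih => intro x y hx hy; exact (ih y x hy hx).symm
        | trans u v w _ _ ih₁ ih₂ =>
          intro x y hx hy
          obtain ⟨t, ht⟩ := hf.surj v
          exact (ih₁ x t hx ht).trans _ _ _ (ih₂ t y ht hy)
      exact key _ _ ((hf₁.eq_iff _ _).1 hxy) x y rfl rfl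
    · intro hxy
      refine (hf₁.eq_iff _ _).2 (Relation.EqvGen.map_of_rel f (fun x y hxy => ?_) hxy)
      by_cases hx : InEdges S x
      · rw [show f x = f y from (hf.eq_iff _ _).2 (.rel _ _ ⟨hx, hxy.2⟩)]
        exact .refl _
      · refine .rel _ _ ⟨((h x).1 hxy.1).resolve_left hx, ?_⟩
        rcases hxy.2 with rfl | rfl
        · exact Or.inl (hf.map_r x)
        · exact Or.inr (hf.map_inv x)
  weight u := by
    rw [hf₁.weight]
    refine (hf.genusOn_preimage _ fun y hy => ?_).symm
    exact hf₁.fiber_inv u.2 y hy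

/-- Two contractions of the same edges give the same weights. -/
theorem IsContraction.weight_eq {S : Set Γ.Edge} {f : Γ.X → Δ.X} {f₁ : Γ.X → Θ.X}
    (hf : Γ.IsContraction Δ S f) (hf₁ : Γ.IsContraction Θ S f₁) {x : Γ.X} (u : Δ.Vertex)
    (u₁ : Θ.Vertex) (hx : f x = u.1) (hx₁ : f₁ x = u₁.1) : Θ.w u₁ = Δ.w u := by
  have h := hf.weight u
  rw [show f ⁻¹' {u.1} = f₁ ⁻¹' {u₁.1} from ?_, ← hf₁.weight] at h
  · exact_mod_cast h.symm
  · ext y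
    change f y = _ ↔ f₁ y = _
    rw [← hx, ← hx₁]
    exact (hf.eq_iff _ _).trans (hf₁.eq_iff _ _).symm

end WGraph

variable {G : Type u} [Group G] {g n : ℕ} {μ : Fin n → ℕ}

/-! ### Contractions as maps of marked covers -/

namespace CoverMap

variable {P Q R : Cover G g μ}

theorem inv_ne_of_map (c : CoverMap P Q) {x : P.target.X}
    (h : Q.target.inv (c.tgt x) ≠ c.tgt x) : P.target.inv x ≠ x := fun h₁ => by
  rw [← c.tgt_inv, h₁] at h
  exact h rfl

theorem map_edgeOf (c : CoverMap P Q) {x : P.target.X} (h : P.target.inv x ≠ x)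
    (h₁ : Q.target.inv (c.tgt x) ≠ c.tgt x) :
    Sym2.map c.tgt (P.target.edgeOf x h).1 = (Q.target.edgeOf (c.tgt x) h₁).1 := by
  change Sym2.map c.tgt s(x, P.target.inv x) = s(c.tgt x, Q.target.inv (c.tgt x))
  rw [Sym2.map_mk, c.tgt_inv]

theorem map_edgeOf_ne (c : CoverMap P Q) {x : P.target.X} (h : P.target.inv x ≠ x)
    (h₁ : Q.target.inv (c.tgt x) = c.tgt x) (e : Q.target.Edge) :
    Sym2.map c.tgt (P.target.edgeOf x h).1 ≠ e.1 := fun he => by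
  refine e.inv_ne_of_mem (x := c.tgt x) ?_ h₁
  rw [← he]
  exact Sym2.mem_map.2 ⟨x, Sym2.mem_mk_left _ _, rfl⟩

theorem extend_edgeOf (c : CoverMap P Q) (a : Q.target.Edge → ℝ) {x : P.target.X}
    (h : P.target.inv x ≠ x) (h₁ : Q.target.inv (c.tgt x) ≠ c.tgt x) :
    c.extend a (P.target.edgeOf x h) = a (Q.target.edgeOf (c.tgt x) h₁) :=
  c.extend_apply_of_eq _ _ _ (c.map_edgeOf h h₁)

theorem extend_edgeOf_of_eq (c : CoverMap P Q) (a : Q.target.Edge → ℝ) {x : P.target.X}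
    (h : P.target.inv x ≠ x) (h₁ : Q.target.inv (c.tgt x) = c.tgt x) :
    c.extend a (P.target.edgeOf x h) = 0 :=
  c.extend_apply_of_ne _ _ (c.map_edgeOf_ne h h₁)

open Classical in
theorem IsIso.isContraction {c : CoverMap P Q} (hc : c.IsIso) {S : Set P.target.Edge}
    (hS : ∀ x, ¬ InEdges S x) : c.IsContraction S where
  tgt := WGraph.isContraction_empty hS c.tgt_r c.tgt_inv hc.tgt_bij hc.tgt_weight
  src := WGraph.isContraction_empty (fun x hx => hS _ ((P.cover.inEdges_iff x).1 hx))
    c.src_r c.src_inv hc.src_bij hc.src_weight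
  degree x := by
    rw [hc.degree, finsum_mem_setOf_eq_sum_filter, Finset.sum_eq_single x]
    · intro y hy hyx
      simp only [Finset.mem_filter, Finset.mem_univ, true_and] at hy
      exact absurd (hc.src_bij.1 hy.1) hyx
    · simp

open Classical in
theorem IsContraction.comp {S : Set P.target.Edge} {S₁ : Set Q.target.Edge}
    {S₂ : Set P.target.Edge} {c : CoverMap P Q} {c₁ : CoverMap Q R} (hc : c.IsContraction S)
    (hc₁ : c₁.IsContraction S₁) (h : ∀ x, InEdges S₂ x ↔ InEdges S x ∨ InEdges S₁ (c.tgt x)) :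
    (c.comp c₁).IsContraction S₂ where
  tgt := hc.tgt.comp hc₁.tgt h
  src := hc.src.comp hc₁.src fun x => by
    rw [P.cover.inEdges_iff, P.cover.inEdges_iff, h, Q.cover.inEdges_iff, c.comm]
  degree x := by
    refine (hc₁.degree (c.src x)).trans ?_
    rw [finsum_mem_setOf_eq_sum_filter, finsum_mem_setOf_eq_sum_filter,
      ← Finset.sum_fiberwise_of_maps_to (g := c.src) (t := Finset.univ.filter fun y =>
        c₁.src y = c₁.src (c.src x) ∧ Q.cover.φ y = Q.cover.φ (c.src x))]
    · refine Finset.sum_congr rfl fun y hy => ?_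
      simp only [Finset.mem_filter, Finset.mem_univ, true_and] at hy
      -- By transitivity `y` is the image of a translate of `x`. The translate lies over the same
      -- point of the target as `x`, so the degree formula of `c` at `y` sums over that same point.
      obtain ⟨a, rfl⟩ := Q.cover.transitive _ _ hy.2.symm
      rw [← c.equivariant] at hy ⊢
      rw [hc.degree, finsum_mem_setOf_eq_sum_filter, Finset.filter_filter]
      refine Finset.sum_congr (Finset.filter_congr fun z _ => ?_) fun _ _ => rfl
      rw [P.cover.invariant]
      refine ⟨fun hz => ⟨⟨?_, hz.2⟩, hz.1⟩, fun hz => ⟨hz.2, hz.1.2⟩⟩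
      change c₁.src (c.src z) = c₁.src (c.src x)
      rw [hz.1, hy.1]
    · intro z hz
      simp only [Finset.mem_filter, Finset.mem_univ, true_and] at hz ⊢
      exact ⟨hz.1, by rw [c.comm, c.comm, hz.2]⟩

/-- The comparison map between two contractions of the same edges. -/
def descend {c : CoverMap P Q} {c₁ : CoverMap P R} {S : Set P.target.Edge}
    (hc : c.IsContraction S) (hc₁ : c₁.IsContraction S) :
    {m : CoverMap Q R // (∀ x, m.src (c.src x) = c₁.src x) ∧ ∀ x, m.tgt (c.tgt x) = c₁.tgt x} :=
  have hs : ∀ x, c₁.src (Function.surjInv hc.src.surj (c.src x)) = c₁.src x := fun x =>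
    (hc₁.src.eq_iff _ _).2 ((hc.src.eq_iff _ _).1 (Function.surjInv_eq hc.src.surj (c.src x)))
  have ht : ∀ x, c₁.tgt (Function.surjInv hc.tgt.surj (c.tgt x)) = c₁.tgt x := fun x =>
    (hc₁.tgt.eq_iff _ _).2 ((hc.tgt.eq_iff _ _).1 (Function.surjInv_eq hc.tgt.surj (c.tgt x)))
  ⟨{ src := fun y => c₁.src (Function.surjInv hc.src.surj y)
     tgt := fun y => c₁.tgt (Function.surjInv hc.tgt.surj y)
     src_r := hc.src.surj.forall.2 fun x => by rw [← c.src_r, hs, hs, c₁.src_r]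
     src_inv := hc.src.surj.forall.2 fun x => by rw [← c.src_inv, hs, hs, c₁.src_inv]
     tgt_r := hc.tgt.surj.forall.2 fun x => by rw [← c.tgt_r, ht, ht, c₁.tgt_r]
     tgt_inv := hc.tgt.surj.forall.2 fun x => by rw [← c.tgt_inv, ht, ht, c₁.tgt_inv]
     comm := hc.src.surj.forall.2 fun x => by rw [hs, c₁.comm, c.comm, ht]
     equivariant := fun a => hc.src.surj.forall.2 fun x => by
       rw [← c.equivariant, hs, hs, c₁.equivariant]
     tgt_mark := fun i => by rw [← c.tgt_mark, ht, c₁.tgt_mark]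
     src_mark := fun p => by rw [← c.src_mark, hs, c₁.src_mark] }, hs, ht⟩

/-- A contraction along given edges has prescribed fibers, and its weights and degrees are computed
from these fibers alone. -/
theorem isIso_descend {c : CoverMap P Q} {c₁ : CoverMap P R} {S : Set P.target.Edge}
    (hc : c.IsContraction S) (hc₁ : c₁.IsContraction S) : (descend hc hc₁).1.IsIso := by
  obtain ⟨m, hs, ht⟩ := descend hc hc₁
  refine ⟨⟨hc.src.surj.forall.2 fun x => hc.src.surj.forall.2 fun y h => ?_,
    hc₁.src.surj.forall.2 fun x => ⟨c.src x, hs x⟩⟩,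
    ⟨hc.tgt.surj.forall.2 fun x => hc.tgt.surj.forall.2 fun y h => ?_,
    hc₁.tgt.surj.forall.2 fun x => ⟨c.tgt x, ht x⟩⟩, fun v v₁ h => ?_, fun v v₁ h => ?_,
    hc.src.surj.forall.2 fun x => ?_⟩
  · dsimp only at h
    rw [hs, hs] at h
    exact (hc.src.eq_iff _ _).2 ((hc₁.src.eq_iff _ _).1 h)
  · dsimp only at h
    rw [ht, ht] at h
    exact (hc.tgt.eq_iff _ _).2 ((hc₁.tgt.eq_iff _ _).1 h)
  · obtain ⟨x, hx⟩ := hc.src.surj v.1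
    refine hc.src.weight_eq hc₁.src v v₁ hx ?_
    rw [← hs, hx]
    exact h
  · obtain ⟨x, hx⟩ := hc.tgt.surj v.1
    refine hc.tgt.weight_eq hc₁.tgt v v₁ hx ?_
    rw [← ht, hx]
    exact h
  · dsimp only
    rw [hs, hc.degree, hc₁.degree]
    congr! 4
    exact Set.ext fun y => and_congr_left' ((hc₁.src.eq_iff _ _).trans (hc.src.eq_iff _ _).symm)

theorem IsContraction.inEdges_of_inv_eq {c : CoverMap P Q} {S : Set P.target.Edge}
    (hc : c.IsContraction S) {x : P.target.X} (h : P.target.inv x ≠ x)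
    (h₁ : Q.target.inv (c.tgt x) = c.tgt x) : InEdges S x := by
  by_contra hx
  have hv : ¬ Q.target.IsVertex (c.tgt x) := fun hv =>
    (hc.tgt.isVertex_iff.1 hv).elim (fun hv => h hv.inv_eq) hx
  exact h ((hc.tgt.inv_eq_iff hv).1 h₁)

theorem IsContraction.inv_eq_of_inEdges {c : CoverMap P Q} {S : Set P.target.Edge}
    (hc : c.IsContraction S) {x : P.target.X} (h : InEdges S x) :
    Q.target.inv (c.tgt x) = c.tgt x :=
  (hc.tgt.isVertex_iff.2 (Or.inr h)).inv_eq

end CoverMap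

/-! ## Realizing points of the cones -/

open Classical in
/-- The cover of tropical curves with given edge lengths on the target. -/
def TropCover.ofLen (Q : Cover G g μ) (len : Q.target.Edge → ℝ) (hlen : ∀ e, 0 < len e) :
    TropCover G g μ where
  graph := Q
  len := len
  len_pos := hlen
  sourceLen e := len (Q.cover.onEdge e) / Q.cover.d e.exists_eq_edgeOf.choose
  sourceLen_pos e := div_pos (hlen _) (Nat.cast_pos.2 (Q.cover.d_pos _))
  dilation e h hh := by
    obtain ⟨hx, he⟩ := e.exists_eq_edgeOf.choose_spec
    -- The two halves of an edge have equal degree, so the chosen half does not matter.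
    have hd : Q.cover.d h = Q.cover.d e.exists_eq_edgeOf.choose := by
      rw [he] at hh
      rcases Sym2.mem_iff.1 hh with h₁ | h₁
      · rw [h₁]
      · rw [h₁, Q.cover.d_inv]
    rw [hd, mul_div_cancel₀]
    exact Nat.cast_ne_zero.2 (Q.cover.d_pos _).ne'

/-- Dilation determines the source lengths from the target lengths and the degrees, and isomorphisms
preserve degrees. -/
theorem TropCover.iso_of_len {T U : TropCover G g μ} {c : CoverMap T.graph U.graph} (hc : c.IsIso)
    (h : ∀ (e : T.graph.target.Edge) (e₁ : U.graph.target.Edge),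
      Sym2.map c.tgt e.1 = e₁.1 → U.len e₁ = T.len e) : T.Iso U := by
  refine ⟨c, hc, h, fun e e₁ he => ?_⟩
  obtain ⟨x, hx, rfl⟩ := e.exists_eq_edgeOf
  have h₁ := T.dilation (LegGraph.edgeOf x hx) x (Sym2.mem_mk_left _ _)
  have h₂ := U.dilation e₁ (c.src x) (by
    rw [← he]; exact Sym2.mem_map.2 ⟨x, Sym2.mem_mk_left _ _, rfl⟩)
  have h₃ := h (T.graph.cover.onEdge _) (U.graph.cover.onEdge e₁) (by
    change Sym2.map c.tgt (Sym2.map T.graph.cover.φ _) = Sym2.map U.graph.cover.φ e₁.1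
    rw [← he, Sym2.map_map, Sym2.map_map]
    congr 1
    exact funext fun y => (c.comm y).symm)
  rw [h₁, h₂, hc.degree] at h₃
  exact mul_left_cancel₀ (Nat.cast_ne_zero.2 (T.graph.cover.d_pos x).ne') h₃

theorem exists_realizes (P : Cover G g μ) (a : P.cone.carrier) : ∃ T, Realizes P a T := by
  have hc := P.isContraction_contractionMap {e | a.1 e = 0}
  choose s hs hu using (CoverMap.Generated.contraction _ _ hc).existsUnique_edge
  refine ⟨TropCover.ofLen (P.contract {e | a.1 e = 0}) (fun e => a.1 (s e)) fun e => ?_,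
    P.contractionMap _, hc, fun e e₁ h => by rw [hu e₁ e h]; rfl⟩
  -- An edge with coordinate zero is contracted to a point, so it cannot map onto `e`.
  refine lt_of_le_of_ne (a.2 (s e)) fun h => ?_
  obtain ⟨x, hx, hxe⟩ := (s e).exists_eq_edgeOf
  have hse := hs e
  rw [hxe] at hse
  refine CoverMap.map_edgeOf_ne _ hx (hc.inv_eq_of_inEdges (inEdges_iff.2 ⟨hx, ?_⟩)) e hse
  rw [← hxe]
  exact h.symm

theorem Realizes.iso {P : Cover G g μ} {a : P.cone.carrier} {T U : TropCover G g μ}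
    (hT : Realizes P a T) (hU : Realizes P a U) : T.Iso U := by
  obtain ⟨c, hc, hlen⟩ := hT
  obtain ⟨c₁, hc₁, hlen₁⟩ := hU
  refine TropCover.iso_of_len (CoverMap.isIso_descend hc hc₁) fun e e₁ he => ?_
  obtain ⟨E, hE, -⟩ := (CoverMap.Generated.contraction _ _ hc).existsUnique_edge e
  rw [hlen E e hE, hlen₁ E e₁]
  rw [← he, ← hE, Sym2.map_map]
  congr 1
  exact funext fun x => ((CoverMap.descend hc hc₁).2.2 x).symm

/-- The coordinates of `c.coneMap a` vanish exactly on the edges in `S` and on those that map to an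
edge where `a` vanishes. These are the edges contracted by the composite. -/
theorem CoverMap.IsContraction.realizes_coneMap {P Q : Cover G g μ} {c : CoverMap P Q}
    {S : Set P.target.Edge} (hc : c.IsContraction S) {a : Q.cone.carrier} {T : TropCover G g μ}
    (hT : Realizes Q a T) : Realizes P (c.coneMap a) T := by
  obtain ⟨c₁, hc₁, hlen⟩ := hT
  refine ⟨c.comp c₁, hc.comp hc₁ fun x => ?_, fun e e₁ he => ?_⟩
  · constructor
    · intro hx
      obtain ⟨h, hx⟩ := inEdges_iff.1 hx
      by_cases h₁ : Q.target.inv (c.tgt x) = c.tgt x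
      · exact Or.inl (hc.inEdges_of_inv_eq h h₁)
      · exact Or.inr (inEdges_iff.2 ⟨h₁, (c.extend_edgeOf a.1 h h₁).symm.trans hx⟩)
    · rintro (hx | hx)
      · exact inEdges_iff.2 ⟨hx.inv_ne,
          c.extend_edgeOf_of_eq a.1 hx.inv_ne (hc.inv_eq_of_inEdges hx)⟩
      · obtain ⟨h₁, hx⟩ := inEdges_iff.1 hx
        exact inEdges_iff.2 ⟨c.inv_ne_of_map h₁, (c.extend_edgeOf a.1 _ h₁).trans hx⟩
  · obtain ⟨x, hx, rfl⟩ := e.exists_eq_edgeOf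
    have h₁ : Q.target.inv (c.tgt x) ≠ c.tgt x := fun h₁ =>
      (c.comp c₁).map_edgeOf_ne hx ((c₁.tgt_inv _).symm.trans (congrArg c₁.tgt h₁)) e₁ he
    refine (hlen (Q.target.edgeOf _ h₁) e₁ ?_).trans (c.extend_edgeOf a.1 hx h₁).symm
    rw [← he, ← c.map_edgeOf hx h₁, Sym2.map_map]
    rfl

theorem not_inEdges_empty {Γ : LegGraph} (x : Γ.X) : ¬ InEdges (∅ : Set Γ.Edge) x :=
  fun ⟨_, h, _⟩ => h

theorem Realizes.coneMap {P Q : Cover G g μ} {c : CoverMap P Q} (hc : c.Generated) :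
    ∀ {a : Q.cone.carrier} {T : TropCover G g μ}, Realizes Q a T → Realizes P (c.coneMap a) T := by
  induction hc with
  | iso c hc => exact (hc.isContraction not_inEdges_empty).realizes_coneMap
  | contraction S c hc => exact hc.realizes_coneMap
  | comp c c₁ _ _ ih ih₁ =>
    intro a T hT
    rw [show (c.comp c₁).coneMap a = c.coneMap (c₁.coneMap a) from
      Subtype.ext (c.extend_comp c₁ a.1)]
    exact ih (ih₁ hT)

/-- The point of the cone given by the edge lengths. -/
def TropCover.point (T : TropCover G g μ) : T.graph.cone.carrier :=
  ⟨T.len, fun e => (T.len_pos e).le⟩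

theorem TropCover.realizes_point (T : TropCover G g μ) : Realizes T.graph T.point T := by
  refine ⟨CoverMap.id _, (CoverMap.isIso_id _).isContraction ?_, fun e e₁ h => ?_⟩
  · rintro x ⟨e, he, -⟩
    exact (T.len_pos e).ne' he
  · rw [show (CoverMap.id T.graph).tgt = _root_.id from rfl, Sym2.map_id] at h
    rw [show e₁ = e from Subtype.ext h.symm]
    rfl

theorem TropCover.Iso.exists_coneMap {T U : TropCover G g μ} (h : T.Iso U) :
    ∃ c : CoverMap T.graph U.graph, c.Generated ∧ T.point = c.coneMap U.point := by
  obtain ⟨c, hc, hlen, -⟩ := h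
  refine ⟨c, .iso c hc, Subtype.ext (funext fun e => ?_)⟩
  obtain ⟨x, hx, rfl⟩ := e.exists_eq_edgeOf
  have h₁ : U.graph.target.inv (c.tgt x) ≠ c.tgt x := fun h₁ =>
    hx (hc.tgt_bij.1 (by rw [c.tgt_inv, h₁]))
  exact (hlen _ _ (c.map_edgeOf hx h₁)).symm.trans (c.extend_edgeOf U.len hx h₁).symm

/-- Extending the positive lengths of the realization by zero on the contracted edges recovers the
point: it lies in the relative interior of the corresponding face. -/
theorem Realizes.exists_coneMap {P : Cover G g μ} {a : P.cone.carrier} {T : TropCover G g μ}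
    (h : Realizes P a T) : ∃ c : CoverMap P T.graph, c.Generated ∧ a = c.coneMap T.point := by
  obtain ⟨c, hc, hlen⟩ := h
  refine ⟨c, .contraction _ c hc, Subtype.ext (funext fun e => ?_)⟩
  obtain ⟨x, hx, rfl⟩ := e.exists_eq_edgeOf
  by_cases h₁ : T.graph.target.inv (c.tgt x) = c.tgt x
  · obtain ⟨_, h₂⟩ := inEdges_iff.1 (hc.inEdges_of_inv_eq hx h₁)
    exact Eq.trans h₂ (c.extend_edgeOf_of_eq T.len hx h₁).symm
  · exact (hlen _ _ (c.map_edgeOf hx h₁)).symm.trans (c.extend_edgeOf T.len hx h₁).symm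

/-! ## Finiteness -/

namespace WGraph

variable {Γ : WGraph}

open Classical in
/-- The weight, extended by zero to the half-edges. -/
def weightExt (Γ : WGraph) (x : Γ.X) : ℕ := if h : Γ.IsVertex x then Γ.w ⟨x, h⟩ else 0

theorem weightExt_vertex (v : Γ.Vertex) : Γ.weightExt v.1 = Γ.w v := by
  rw [weightExt, dif_pos v.2]

theorem sum_eulerWeight_eq (Γ : WGraph) :
    ∑ x, Γ.eulerWeight x = 2 * Γ.genus - 2 + Nat.card Γ.Leg := by
  classical
  have h := two_mul_genusOn (Γ := Γ) Set.univ fun _ _ => trivial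
  have h₁ : ∑ x, Γ.eulerWeight x = ∑ x, Γ.genusWeight x + Nat.card Γ.Leg := by
    rw [Nat.card_eq_fintype_card, Fintype.card_subtype, Finset.card_filter, Nat.cast_sum,
      ← Finset.sum_add_distrib]
    refine Finset.sum_congr rfl fun x _ => ?_
    by_cases hx : ¬ Γ.IsVertex x ∧ Γ.inv x = x
    · rw [genusWeight, if_pos hx, if_pos hx, eulerWeight_of_not_isVertex hx.1]
      rfl
    · rw [genusWeight, if_neg hx, if_neg hx, Nat.cast_zero, add_zero]
  simp only [Set.mem_univ, Finset.filter_true] at h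
  rw [h₁, genus, h]
  ring

/-- The numbers `-χ(v)` sum to the right-hand side, and stability makes each at least one. -/
theorem card_vertex_le_of_stable (h : Γ.Stable) : (Nat.card Γ.Vertex : ℤ) ≤
    2 * Γ.genus - 2 + Nat.card Γ.Leg := by
  classical
  have h₁ := sum_neg_chi (Γ := Γ) fun _ => True
  rw [Finset.filter_true, sum_eulerWeight_eq] at h₁
  rw [← h₁, Nat.card_congr (Equiv.subtypeUnivEquiv (p := fun _ : Γ.Vertex => True)
    fun _ => trivial).symm, Nat.card_eq_fintype_card]
  refine le_trans (le_of_eq ?_) (Finset.card_nsmul_le_sum _ _ 1 fun v _ => ?_)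
  · rw [nsmul_one, Finset.card_univ]
  · have := h v.1
    omega

/-- A vertex contributes `1 + 2 g(v)`, which is its `eulerWeight` plus three; a half-edge
contributes exactly its `eulerWeight`. The factor four is one for the total weight plus three for
the number of vertices. -/
theorem card_add_le_of_stable (h : Γ.Stable) :
    (Nat.card Γ.X : ℤ) + 2 * ∑ x, (Γ.weightExt x : ℤ) ≤
      4 * (2 * Γ.genus - 2 + Nat.card Γ.Leg) := by
  classical
  have h₁ : (Nat.card Γ.X : ℤ) + 2 * ∑ x, (Γ.weightExt x : ℤ) =
      ∑ x, Γ.eulerWeight x + 3 * Nat.card Γ.Vertex := by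
    rw [Nat.card_eq_fintype_card, Nat.card_eq_fintype_card, Fintype.card_subtype,
      ← Finset.card_univ, Finset.cast_card, Finset.card_filter, Nat.cast_sum, Finset.mul_sum,
      Finset.mul_sum, ← Finset.sum_add_distrib, ← Finset.sum_add_distrib]
    refine Finset.sum_congr rfl fun x _ => ?_
    by_cases hx : Γ.IsVertex x
    · rw [if_pos hx, weightExt_vertex ⟨x, hx⟩, eulerWeight_vertex ⟨x, hx⟩]
      push_cast
      ring
    · rw [if_neg hx, weightExt, dif_neg hx, eulerWeight_of_not_isVertex hx]
      rfl
  have h₂ := card_vertex_le_of_stable h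
  rw [h₁, sum_eulerWeight_eq]
  omega

theorem card_le_of_stable (h : Γ.Stable) :
    Nat.card Γ.X ≤ (4 * (2 * Γ.genus - 2 + Nat.card Γ.Leg)).toNat ∧
      ∀ x, Γ.weightExt x ≤ (4 * (2 * Γ.genus - 2 + Nat.card Γ.Leg)).toNat := by
  have h₁ := card_add_le_of_stable h
  have h₂ : 0 ≤ ∑ x, (Γ.weightExt x : ℤ) := Finset.sum_nonneg fun _ _ => Int.natCast_nonneg _
  refine ⟨by omega, fun x => ?_⟩
  have h₃ : (Γ.weightExt x : ℤ) ≤ ∑ x, (Γ.weightExt x : ℤ) :=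
    Finset.single_le_sum (f := fun x => (Γ.weightExt x : ℤ))
      (fun _ _ => Int.natCast_nonneg _) (Finset.mem_univ x)
  omega

end WGraph

/-! ### Bounds on covers and their codes -/

variable {G : Type u} [Group G]

/-- At a vertex the degree is one summand of the total degree; at a half-edge it is one summand of
the degree at its root. -/
theorem GCover.d_le {Γs Γ : WGraph} (c : GCover G Γs Γ) (x : Γs.X) : c.d x ≤ Nat.card G := by
  classical
  have hv : ∀ x, Γs.IsVertex x → c.d x ≤ Nat.card G := fun x hx => by
    rw [← c.degree ⟨c.φ x, (c.isVertex_iff x).2 hx⟩, finsum_mem_setOf_eq_sum_filter]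
    exact Finset.single_le_sum (f := c.d) (fun _ _ => Nat.zero_le _) (by simp)
  by_cases hx : Γs.IsVertex x
  · exact hv x hx
  · refine le_trans ?_ (hv _ (isVertex_r x))
    rw [c.d_eq_sum (Γs.r x) (c.φ x) (mt (c.isVertex_iff x).1 hx) (c.map_r x)]
    exact Finset.single_le_sum (f := c.d) (fun _ _ => Nat.zero_le _) (by simp)

/-- If two decorated subsets of a set agree, then there is a bijection between them that preserves
the decorations. -/
theorem exists_bijective_of_extend_eq {α β γ δ : Type*} {e : α → γ} {e₁ : β → γ}
    (he : e.Injective) (he₁ : e₁.Injective) {d : α → δ} {d₁ : β → δ}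
    (h : Function.extend e (fun x => some (d x)) (fun _ => none) =
      Function.extend e₁ (fun x => some (d₁ x)) (fun _ => none)) :
    ∃ m : α → β, Function.Bijective m ∧ (∀ x, e₁ (m x) = e x) ∧ ∀ x, d₁ (m x) = d x := by
  have key : ∀ x, ∃ y, e₁ y = e x ∧ d₁ y = d x := fun x => by
    have hx := congrFun h (e x)
    rw [he.extend_apply] at hx
    by_cases hy : ∃ y, e₁ y = e x
    · obtain ⟨y, hy⟩ := hy
      rw [← hy, he₁.extend_apply] at hx
      exact ⟨y, hy, (Option.some.inj hx).symm⟩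
    · rw [Function.extend_apply' _ _ _ hy] at hx
      cases hx
  choose m hm hd using key
  refine ⟨m, ⟨fun x y hxy => he (by rw [← hm, ← hm, hxy]), fun y => ?_⟩, hm, hd⟩
  by_cases hx : ∃ x, e x = e₁ y
  · obtain ⟨x, hx⟩ := hx
    exact ⟨x, he₁ (by rw [hm, hx])⟩
  · have hy := congrFun h (e₁ y)
    rw [he₁.extend_apply, Function.extend_apply' _ _ _ hx] at hy
    cases hy

variable {g n : ℕ} {μ : Fin n → ℕ}

variable (G g μ) in
theorem Cover.exists_bound : ∃ N : ℕ, ∀ P : Cover G g μ,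
    Nonempty (P.source.X ↪ Fin N) ∧ Nonempty (P.target.X ↪ Fin N) ∧
    (∀ x, P.source.weightExt x < N) ∧ (∀ x, P.target.weightExt x < N) ∧
    ∀ x, P.cover.d x < N := by
  let N₁ := (4 * (2 * sourceGenus G g μ - 2 +
    Nat.card (Σ i : Fin n, Fin (Nat.card G / μ i)))).toNat
  let N₂ := (4 * (2 * (g : ℤ) - 2 + Nat.card (Fin n))).toNat
  -- One number serves for cardinalities, weights and degrees; the last summand makes the bounds
  -- strict, so that weights and degrees become elements of `Fin N`.
  refine ⟨N₁ + N₂ + Nat.card G + 1, fun P => ?_⟩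
  have h₁ := WGraph.card_le_of_stable P.source_stable
  have h₂ := WGraph.card_le_of_stable P.target_stable
  rw [P.source_genus, ← Nat.card_congr P.sourceMark] at h₁
  rw [P.target_genus, ← Nat.card_congr P.mark] at h₂
  change _ ≤ N₁ ∧ ∀ x, _ ≤ N₁ at h₁
  change _ ≤ N₂ ∧ ∀ x, _ ≤ N₂ at h₂
  rw [Nat.card_eq_fintype_card] at h₁ h₂
  refine ⟨Function.Embedding.nonempty_of_card_le ?_, Function.Embedding.nonempty_of_card_le ?_,
    fun x => ?_, fun x => ?_, fun x => ?_⟩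
  · rw [Fintype.card_fin]; omega
  · rw [Fintype.card_fin]; omega
  · have := h₁.2 x; omega
  · have := h₂.2 x; omega
  · have := P.cover.d_le x; omega

/-- A numbering of the points of a cover, where the numbers also bound the weights and degrees. -/
structure Cover.Numbering (P : Cover G g μ) (N : ℕ) where
  src : P.source.X ↪ Fin N
  tgt : P.target.X ↪ Fin N
  src_weight : ∀ x, P.source.weightExt x < N
  tgt_weight : ∀ x, P.target.weightExt x < N
  d_lt : ∀ x, P.cover.d x < N

namespace Cover.Numbering

variable {P Q : Cover G g μ} {N : ℕ}

/-- The structure of the source, in terms of a numbering. -/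
def srcData (e : P.Numbering N) (x : P.source.X) :
    (Fin N × Fin N) × (Fin N × Fin N) × Fin N × (G → Fin N) :=
  ((e.src (P.source.r x), e.src (P.source.inv x)),
    (⟨P.source.weightExt x, e.src_weight x⟩, ⟨P.cover.d x, e.d_lt x⟩),
    e.tgt (P.cover.φ x), fun a => e.src (P.cover.act a x))

/-- The structure of the target, in terms of a numbering. -/
def tgtData (e : P.Numbering N) (x : P.target.X) : (Fin N × Fin N) × Fin N :=
  ((e.tgt (P.target.r x), e.tgt (P.target.inv x)), ⟨P.target.weightExt x, e.tgt_weight x⟩)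

/-- All the structure of a cover, in terms of a numbering. -/
def code (e : P.Numbering N) :
    ((Fin N → Option ((Fin N × Fin N) × (Fin N × Fin N) × Fin N × (G → Fin N))) ×
      (Fin N → Option ((Fin N × Fin N) × Fin N))) ×
    ((Σ i : Fin n, Fin (Nat.card G / μ i)) → Fin N) × (Fin n → Fin N) :=
  ((Function.extend e.src (fun x => some (e.srcData x)) fun _ => none,
    Function.extend e.tgt (fun x => some (e.tgtData x)) fun _ => none),
    fun p => e.src (P.sourceMark p).1, fun i => e.tgt (P.mark i).1)

theorem exists_isIso_of_code_eq {e : P.Numbering N} {e₁ : Q.Numbering N} (h : e.code = e₁.code) :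
    ∃ c : CoverMap P Q, c.IsIso ∧ (∀ x, e₁.src (c.src x) = e.src x) ∧
      ∀ x, e₁.tgt (c.tgt x) = e.tgt x := by
  simp only [code, Prod.mk.injEq] at h
  obtain ⟨⟨hs, ht⟩, hsm, htm⟩ := h
  obtain ⟨s, hsb, hse, hsd⟩ := exists_bijective_of_extend_eq e.src.injective e₁.src.injective hs
  obtain ⟨t, htb, hte, htd⟩ := exists_bijective_of_extend_eq e.tgt.injective e₁.tgt.injective ht
  simp only [srcData, tgtData, Prod.mk.injEq, Fin.mk.injEq, ← hse, ← hte, funext_iff,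
    EmbeddingLike.apply_eq_iff_eq] at hsd htd hsm htm
  refine ⟨⟨s, t, fun x => (hsd x).1.1.symm, fun x => (hsd x).1.2.symm,
    fun x => (htd x).1.1.symm, fun x => (htd x).1.2.symm, fun x => (hsd x).2.2.1,
    fun a x => ((hsd x).2.2.2 a).symm, htm, hsm⟩,
    ⟨hsb, htb, fun v v₁ hv => ?_, fun v v₁ hv => ?_, fun x => (hsd x).2.1.2⟩, hse, hte⟩
  · have := (hsd v.1).2.1.1
    rwa [show s v.1 = v₁.1 from hv, WGraph.weightExt_vertex, WGraph.weightExt_vertex] at this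
  · have := (htd v.1).2
    rwa [show t v.1 = v₁.1 from hv, WGraph.weightExt_vertex, WGraph.weightExt_vertex] at this

/-- The isomorphisms obtained in the two directions both respect the numberings. As numberings are
injective, they are inverse to each other. -/
theorem isIsomorphic_of_code_eq {e : P.Numbering N} {e₁ : Q.Numbering N} (h : e.code = e₁.code) :
    Nonempty (P ≅ Q) := by
  obtain ⟨c, hc, hs, ht⟩ := exists_isIso_of_code_eq h
  obtain ⟨c₁, hc₁, hs₁, ht₁⟩ := exists_isIso_of_code_eq h.symm
  refine ⟨⟨⟨c, .iso c hc⟩, ⟨c₁, .iso c₁ hc₁⟩, ?_, ?_⟩⟩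
  · refine Subtype.ext (CoverMap.ext (funext fun x => e.src.injective ?_)
      (funext fun x => e.tgt.injective ?_))
    · exact (hs₁ _).trans (hs x)
    · exact (ht₁ _).trans (ht x)
  · refine Subtype.ext (CoverMap.ext (funext fun x => e₁.src.injective ?_)
      (funext fun x => e₁.tgt.injective ?_))
    · exact (hs _).trans (hs₁ x)
    · exact (ht _).trans (ht₁ x)

end Cover.Numbering

theorem Cover.finite_isoClasses [Finite G] :
    Finite (Quotient (isIsomorphicSetoid (Cover G g μ)ᵒᵖ)) := by
  obtain ⟨N, hN⟩ := Cover.exists_bound G g μ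
  let e : ∀ P : Cover G g μ, P.Numbering N := fun P =>
    ⟨(hN P).1.some, (hN P).2.1.some, (hN P).2.2.1, (hN P).2.2.2.1, (hN P).2.2.2.2⟩
  refine Finite.of_injective (fun q : Quotient (isIsomorphicSetoid (Cover G g μ)ᵒᵖ) =>
    (e q.out.unop).code) fun q q₁ h => ?_
  obtain ⟨i⟩ := Cover.Numbering.isIsomorphic_of_code_eq h
  rw [← q.out_eq, ← q₁.out_eq]
  exact Quotient.sound ⟨i.symm.op⟩

theorem Cover.finite_hom (P Q : Cover G g μ) : Finite (P ⟶ Q) := by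
  refine Finite.of_injective (β := (P.source.X → Q.source.X) × (P.target.X → Q.target.X))
    (fun c => (c.1.src, c.1.tgt)) fun c c₁ h => ?_
  exact Subtype.ext (CoverMap.ext (congrArg Prod.fst h) (congrArg Prod.snd h))

end TropGCover

end

/-! ### The moduli space as a colimit of cones -/

theorem mainTheorem9 {G : Type u} [Group G] [Finite G] (g n : ℕ) (hg : 2 ≤ g) (μ : Fin n → ℕ)
    (hμ : ∀ i, μ i ∣ Nat.card G)
    (heven : Even ((n : ℤ) * Nat.card G - TropGCover.numLegs G μ)) :
    (∀ (P : TropGCover.Cover G g μ) (a : P.cone.carrier), ∃ T, TropGCover.Realizes P a T) ∧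
    ∃ π : ∀ P : TropGCover.Cover G g μ, P.cone.carrier → TropGCover.HTrop G g μ,
      (∀ P a T, TropGCover.Realizes P a T → π P a = Quotient.mk (TropGCover.tropSetoid G g μ) T) ∧
      ∃ _ : TopologicalSpace (TropGCover.HTrop G g μ),
        TropGCover.IsGeneralizedConeComplex (TropGCover.coneFunctor G g μ)
          (fun P => π P.unop) := by
  refine ⟨TropGCover.exists_realizes, ?_⟩
  choose T hT using TropGCover.exists_realizes (G := G) (g := g) (μ := μ)
  let π : ∀ P : TropGCover.Cover G g μ, P.cone.carrier → TropGCover.HTrop G g μ :=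
    fun P a => Quotient.mk (TropGCover.tropSetoid G g μ) (T P a)
  have hπ : ∀ P a T, TropGCover.Realizes P a T →
      π P a = Quotient.mk (TropGCover.tropSetoid G g μ) T :=
    fun P a U hU => Quotient.sound ((hT P a).iso hU)
  -- The supremum of the coinduced topologies is the colimit topology: a set is open when all its
  -- preimages in the cones are.
  refine ⟨π, hπ, ⨆ P, TopologicalSpace.coinduced (π P) inferInstance, ?_⟩
  let _ : TopologicalSpace (TropGCover.HTrop G g μ) :=
    ⨆ P, TopologicalSpace.coinduced (π P) inferInstance
  refine
    { finite_isoClasses := TropGCover.Cover.finite_isoClasses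
      finite_hom := fun i j => ?_
      compat := fun {i j} m a => hπ _ _ _ ((hT i.unop a).coneMap m.unop.2)
      surj := ?_
      inj := ?_
      isOpen_iff := fun U => ?_ }
  · have := TropGCover.Cover.finite_hom j.unop i.unop
    exact Finite.of_injective (fun m : i ⟶ j => m.unop) Quiver.Hom.unop_inj
  · rintro ⟨U⟩
    exact ⟨Opposite.op U.graph, U.point, hπ _ _ _ U.realizes_point⟩
  · rintro ⟨P, a⟩ ⟨Q, b⟩ h
    have hiso : (T P.unop a).Iso (T Q.unop b) := Quotient.exact h
    obtain ⟨c, hc, hca⟩ := (hT P.unop a).exists_coneMap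
    obtain ⟨c₁, hc₁, hcb⟩ := (hT Q.unop b).exists_coneMap
    obtain ⟨m, hm, hmp⟩ := hiso.exists_coneMap
    let p : Σ i, ((TropGCover.coneFunctor G g μ).obj i).carrier :=
      ⟨Opposite.op (T P.unop a).graph, (T P.unop a).point⟩
    let q : Σ i, ((TropGCover.coneFunctor G g μ).obj i).carrier :=
      ⟨Opposite.op (T Q.unop b).graph, (T Q.unop b).point⟩
    -- The zigzag is `(P, a) ← p ← q → (Q, b)`: the outer arrows embed the interior points of the
    -- two realizations as faces, and the middle one is the isomorphism between the realizations.
    refine .trans _ p _ (.symm p _ (.rel p _ ⟨Quiver.Hom.op ⟨c, hc⟩, hca⟩)) ?_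
    refine .trans _ q _ (.symm q p (.rel q p ⟨Quiver.Hom.op ⟨m, hm⟩, hmp⟩)) ?_
    exact .rel q _ ⟨Quiver.Hom.op ⟨c₁, hc₁⟩, hcb⟩
  · rw [isOpen_iSup_iff]
    exact ⟨fun h i => isOpen_coinduced.1 (h i.unop), fun h P => isOpen_coinduced.2 (h (.op P))⟩
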